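/- **Setting.** Let $\mathcal M$ be a (Hausdorff, finite-dimensional, boundaryless) smooth Riemannian manifold, with Levi-Civita connection $\nabla$ and induced covariant derivative $\frac{\mathrm D}{\mathrm dt}$ along curves; $c''=\frac{\mathrm D}{\mathrm dt}c'$ denotes the intrinsic acceleration of a curve $c$, and $\mathrm{Hess} f=\nabla\,\mathrm{grad} f$. A *retraction* is a smooth map $\mathrm R:\mathrm T\mathcal M\to\mathcal M$, $\mathrm R_x(s)=\mathrm R(x,s)$, with $\mathrm R_x(0)=x$ and $\mathrm D\mathrm R_x(0)=\mathrm{Id}$ for all $x$. For $S\subseteq \mathrm T\mathcal M$, $\mathrm R$ is *second-order nice on $S$ with constants $c_1,c_2,c_3$* if for all $(x,s)\in S$ and all $\dot s\in\mathrm T_x\mathcal M$, with $T_s=\mathrm D\mathrm R_x(s)$: (1) $\|T_{ts}\|_{\mathrm{op}}\le c_1$ for all $t\in[0,1]$; (2) $\|\frac{\mathrm D}{\mathrm dt}U(t)\|\le c_2\|s\|\|\dot s\|$ for all $t\in[0,1]$, where $U(t)=T_{ts}\dot s$ along $t\mapsto\mathrm R_x(ts)$; (3) $\|c''(0)\|\le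 c_3\|s\|\|\dot s\|^2$, where $c(t)=\mathrm R_x(s+t\dot s)$. It is second-order nice on $S$ if such constants exist. **Algorithm (ARC).** Parameters: $\theta>0$, $\varsigma_{\min}>0$, $0<\eta_1\le\eta_2<1$, $0<\gamma_1<1<\gamma_2<\gamma_3$; input $x_0\in\mathcal M$, $\varsigma_0\ge\varsigma_{\min}$. At iteration $k$, with the pullback $\hat f_k=f\circ\mathrm R_{x_k}$ and $m_k(s)=\hat f_k(0)+\langle s,\nabla\hat f_k(0)\rangle+\frac12\langle s,\nabla^2\hat f_k(0)[s]\rangle+\frac{\varsigma_k}3\|s\|^3$, a step $s_k\in\mathrm T_{x_k}\mathcal M$ is chosen with $m_k(s_k)\le m_k(0)$ and $\|\nabla m_k(s_k)\|\le\theta\|s_k\|^2$ (and possibly further conditions). If $s_k=0$ the algorithm terminates. Otherwise let $\rho_k=\dfrac{f(x_k)-f(\mathrm R_{x_k}(s_k))}{m_k(0)-m_k(s_k)+\frac{\varsigma_k}3\|s_k\|^3}$; iteration $k$ is *successful* if $\rho_k\ge\eta_1$, and then $x_{k+1}=\mathrm R_{x_k}(s_k)$; otherwise $x_{k+1}=x_k$.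 Finally $\varsigma_{k+1}$ is any element of $[\max(\varsigma_{\min},\gamma_1\varsigma_k),\varsigma_k]$ if $\rho_k\ge\eta_2$, of $[\varsigma_k,\gamma_2\varsigma_k]$ if $\rho_k\in[\eta_1,\eta_2)$, and of $[\gamma_2\varsigma_k,\gamma_3\varsigma_k]$ if $\rho_k<\eta_1$. **Regularity assumptions.** *A2 with constant $L$*: $f$ is $C^2$ and, at each iteration $k$, $\hat f_k(s_k)-\big[\hat f_k(0)+\langle s_k,\nabla\hat f_k(0)\rangle+\frac12\langle s_k,\nabla^2\hat f_k(0)[s_k]\rangle\big]\le\frac L6\|s_k\|^3$. *A4 with constant $L'$ and continuous $q:\mathbb R^+\to\mathbb R^+$, $q(0)=0$*: at each successful iteration $k$, $\|\nabla\hat f_k(s_k)-\nabla\hat f_k(0)-\nabla^2\hat f_k(0)[s_k]\|\le\frac{L'}2\|s_k\|^2+q(\|s_k\|)\,\|\mathrm{grad} f(\mathrm R_{x_k}(s_k))\|$. **Theorem.** Let $f:\mathcal M\to\mathbb R$ be three times continuously differentiable, let $\mathrm R$ be a retraction, and let $\{(x_0,s_0),(x_1,s_1),\dots\}$ be the (finite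 or infinite) set of points and steps generated by a run of ARC. Assume $\mathrm R$ is second-order nice on this set. 1. If the iterates $x_0,x_1,\dots$ remain in a compact subset of $\mathcal M$, then: - there is a constant $L$ such that A2 holds with $L$ and A4 holds with $L'=L$ and $q\equiv0$; - the set $\mathcal N=\bigcup_k\{\mathrm R_{x_k}(ts_k):t\in[0,1]\}$ is contained in a compact set; - if $\mathrm R$ is second-order nice with constants $c_1,c_2,c_3$ on $\{(x_k,ts_k): k\geq 0,\ t\in[0,1]\}$, then, for every compact $\mathcal K\supseteq\mathcal N$, the maxima $G=\max_{y\in\mathcal K}\|\mathrm{grad} f(y)\|$, $H=\max_{y\in\mathcal K}\|\mathrm{Hess} f(y)\|_{\mathrm{op}}$ and $J=\max_{y\in\mathcal K,\,v\in\mathrm T_y\mathcal M,\,\|v\|\le1}\|\nabla_v\mathrm{Hess} f\|_{\mathrm{op}}$ exist, and one can take $L=c_3G+2c_1c_2H+c_1^3J$. 2. The algorithm is a descent method: $f(x_{k+1})\le f(x_k)$. Hence, if the sublevel set $\{x\in\mathcal M: f(x)\le f(x_0)\}$ is compact (a fortiori, if $\mathcal M$ is compact), the iterates remain in a compact set and the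 conclusions of 1. hold. -/

import Mathlib

set_option maxSynthPendingDepth 3

open Bundle
open scoped Manifold ContDiff NNReal Gradient

noncomputable section

namespace ManifoldARC

/-! ## Christoffel symbols of a metric on an open subset of a vector space -/

section Christoffel

variable {E : Type*} [NormedAddCommGroup E] [NormedSpace ℝ E]

/-- Christoffel symbols of the first kind of a metric `G` at `z`, as the trilinear form
`(u, v, w) ↦ (1/2) (D_u G (v, w) + D_v G (u, w) - D_w G (u, v))`. -/
def christoffelFirst (G : E → E →L[ℝ] E →L[ℝ] ℝ) (z : E) : E →L[ℝ] E →L[ℝ] E →L[ℝ] ℝ :=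
  let dG : E →L[ℝ] E →L[ℝ] E →L[ℝ] ℝ := fderiv ℝ G z
  (1 / 2 : ℝ) • (dG + dG.flip -
    (ContinuousLinearMap.flipₗᵢ ℝ E E ℝ).toContinuousLinearEquiv.toContinuousLinearMap ∘L dG.flip)

/-- Christoffel symbols of the second kind, obtained by raising the last index with the inverse of
`G z : E → E*`, so that `G z (christoffel G z u v) w = christoffelFirst G z u v w`. -/
def christoffel (G : E → E →L[ℝ] E →L[ℝ] ℝ) (z : E) : E →L[ℝ] E →L[ℝ] E :=
  (ContinuousLinearMap.compL ℝ E (E →L[ℝ] ℝ) E (G z).inverse) ∘L christoffelFirst G z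

end Christoffel

/-! ## Riemannian geometry

`M` is a smooth manifold without boundary modelled on a finite-dimensional real vector space `E`.
The Riemannian metric is a smooth inner product on the tangent spaces; all norms, operator norms
and gradients on tangent spaces are those of that inner product.

Objects at a point `x` are computed in the preferred chart around `x`. In Mathlib the tangent space
at `x` is identified with `E` through the differential at `x` of precisely that chart. -/

section Geometry

variable {E : Type*} [NormedAddCommGroup E] [NormedSpace ℝ E] [FiniteDimensional ℝ E]
  {M : Type*} [TopologicalSpace M] [ChartedSpace E M] [IsManifold 𝓘(ℝ, E) ∞ M]
  [RiemannianBundle (fun x : M => TangentSpace 𝓘(ℝ, E) x)]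

instance tangentSpaceFiniteDimensional (x : M) :
    FiniteDimensional ℝ (TangentSpace 𝓘(ℝ, E) x) :=
  inferInstanceAs (FiniteDimensional ℝ E)

instance tangentSpaceComplete (x : M) : CompleteSpace (TangentSpace 𝓘(ℝ, E) x) :=
  FiniteDimensional.complete ℝ _

/-- The metric in the coordinates of the chart at `x`: the bilinear form `(g_{ij}(z))` on `E`. -/
def metricCoord (x : M) (z : E) : E →L[ℝ] E →L[ℝ] ℝ :=
  let y : M := (extChartAt 𝓘(ℝ, E) x).symm z
  let e : E →L[ℝ] TangentSpace 𝓘(ℝ, E) y :=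
    (trivializationAt E (TangentSpace 𝓘(ℝ, E)) x).symmL ℝ y
  (innerSL ℝ : TangentSpace 𝓘(ℝ, E) y →L[ℝ] TangentSpace 𝓘(ℝ, E) y →L[ℝ] ℝ).bilinearComp e e

theorem metricCoord_self (x : M) (u v : TangentSpace 𝓘(ℝ, E) x) :
    metricCoord x (extChartAt 𝓘(ℝ, E) x x) u v = inner ℝ u v := by
  have h : (extChartAt 𝓘(ℝ, E) x).symm (extChartAt 𝓘(ℝ, E) x x) = x := extChartAt_to_inv x
  have h1 : metricCoord x (extChartAt 𝓘(ℝ, E) x x) u v =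
      inner ℝ ((trivializationAt E (TangentSpace 𝓘(ℝ, E)) x).symmL ℝ x u)
        ((trivializationAt E (TangentSpace 𝓘(ℝ, E)) x).symmL ℝ x v) := by
    unfold metricCoord
    rw [h]
    rfl
  refine h1.trans ?_
  have h2 : ∀ w : TangentSpace 𝓘(ℝ, E) x,
      (trivializationAt E (TangentSpace 𝓘(ℝ, E)) x).symmL ℝ x w = w := by
    intro w
    refine (congrArg (fun L => L w) (TangentBundle.symmL_trivializationAt_eq_core
      (I := 𝓘(ℝ, E)) (M := M) (b := x) (b₀ := x) (mem_chart_source E x))).trans ?_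
    exact (tangentBundleCore 𝓘(ℝ, E) M).coordChange_self (achart E x) x (mem_chart_source E x) w
  erw [h2 u, h2 v]

/-- The Christoffel symbols of the metric at `x`, in the chart at `x`. -/
def christoffelAt (x : M) :
    TangentSpace 𝓘(ℝ, E) x →L[ℝ] TangentSpace 𝓘(ℝ, E) x →L[ℝ] TangentSpace 𝓘(ℝ, E) x :=
  let Γ : E →L[ℝ] E →L[ℝ] E := christoffel (metricCoord x) (extChartAt 𝓘(ℝ, E) x x)
  Γ

/-- The Christoffel symbols are characterized by
`⟪Γ(u, v), w⟫ = (1/2) (D_u g (v, w) + D_v g (u, w) - D_w g (u, v))`. -/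
theorem inner_christoffelAt (x : M) (u v w : TangentSpace 𝓘(ℝ, E) x) :
    inner ℝ (christoffelAt x u v) w =
      christoffelFirst (metricCoord x) (extChartAt 𝓘(ℝ, E) x x) u v w := by
  have hinv : (metricCoord x (extChartAt 𝓘(ℝ, E) x x)).IsInvertible := by
    have hinj : Function.Injective (metricCoord x (extChartAt 𝓘(ℝ, E) x x)).toLinearMap := by
      rw [← LinearMap.ker_eq_bot, LinearMap.ker_eq_bot']
      intro a ha
      have h1 : metricCoord x (extChartAt 𝓘(ℝ, E) x x) a a = 0 := congrArg (fun L => L a) ha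
      rw [metricCoord_self x a a] at h1
      have h2 : (show TangentSpace 𝓘(ℝ, E) x from a) = 0 := inner_self_eq_zero.mp h1
      exact h2
    have hd : Module.finrank ℝ E = Module.finrank ℝ (E →L[ℝ] ℝ) := by
      rw [← (LinearMap.toContinuousLinearMap (𝕜 := ℝ) (E := E) (F' := ℝ)).finrank_eq]
      exact Subspace.dual_finrank_eq.symm
    refine ⟨(LinearEquiv.ofInjectiveOfFinrankEq _ hinj hd).toContinuousLinearEquiv, ?_⟩
    ext a b
    rfl
  rw [← metricCoord_self]
  obtain ⟨e, he⟩ := hinv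
  show metricCoord x (extChartAt 𝓘(ℝ, E) x x)
    ((metricCoord x (extChartAt 𝓘(ℝ, E) x x)).inverse
      (christoffelFirst (metricCoord x) (extChartAt 𝓘(ℝ, E) x x) u v)) w = _
  rw [← he, ContinuousLinearMap.inverse_equiv]
  simp

/-- The vector field `X` in the coordinates of the chart at `x`. -/
def vectorFieldCoord (X : ∀ y : M, TangentSpace 𝓘(ℝ, E) y) (x : M) (z : E) : E :=
  let y : M := (extChartAt 𝓘(ℝ, E) x).symm z
  (trivializationAt E (TangentSpace 𝓘(ℝ, E)) x ⟨y, X y⟩).2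

/-- The Riemannian (Levi-Civita) connection: `leviCivita X x v = ∇_v X`, given in the chart at `x`
by `D_v X + Γ(v, X)`. -/
def leviCivita (X : ∀ y : M, TangentSpace 𝓘(ℝ, E) y) (x : M) :
    TangentSpace 𝓘(ℝ, E) x →L[ℝ] TangentSpace 𝓘(ℝ, E) x :=
  let dX : E →L[ℝ] E := fderiv ℝ (vectorFieldCoord X x) (extChartAt 𝓘(ℝ, E) x x)
  let Γ : E →L[ℝ] E →L[ℝ] E := christoffelAt x
  let D : E →L[ℝ] E := dX + Γ.flip (X x)
  D

/-- Velocity `c'(t)` of a curve. -/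
def velocity (c : ℝ → M) (t : ℝ) : TangentSpace 𝓘(ℝ, E) (c t) :=
  mfderiv 𝓘(ℝ, ℝ) 𝓘(ℝ, E) c t (1 : ℝ)

/-- Covariant derivative `(D/dt) U` at `t` of a vector field `U` along a curve `c`, for the
Riemannian connection: in the chart at `c t` it is `U' + Γ(c', U)`. -/
def covDerivAlong (c : ℝ → M) (U : ∀ t, TangentSpace 𝓘(ℝ, E) (c t)) (t : ℝ) :
    TangentSpace 𝓘(ℝ, E) (c t) :=
  let dU : E := deriv (fun τ => (trivializationAt E (TangentSpace 𝓘(ℝ, E)) (c t) ⟨c τ, U τ⟩).2) t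
  (show TangentSpace 𝓘(ℝ, E) (c t) from dU) + christoffelAt (c t) (velocity c t) (U t)

/-- Intrinsic acceleration `c''(t)` of a curve. -/
def acceleration (c : ℝ → M) (t : ℝ) : TangentSpace 𝓘(ℝ, E) (c t) :=
  covDerivAlong c (velocity c) t

/-- Covariant derivative `∇_v A` at `x` of a field `A` of endomorphisms of the tangent spaces: in
the chart at `x`, `(∇_v A)[w] = (D_v A)[w] + Γ(v, A w) - A Γ(v, w)`. -/
def covDerivEnd (A : ∀ y : M, TangentSpace 𝓘(ℝ, E) y →L[ℝ] TangentSpace 𝓘(ℝ, E) y) (x : M)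
    (v : TangentSpace 𝓘(ℝ, E) x) : TangentSpace 𝓘(ℝ, E) x →L[ℝ] TangentSpace 𝓘(ℝ, E) x :=
  let Acoord : E → E →L[ℝ] E := fun z =>
    let y : M := (extChartAt 𝓘(ℝ, E) x).symm z
    ContinuousLinearMap.inCoordinates E (TangentSpace 𝓘(ℝ, E)) E (TangentSpace 𝓘(ℝ, E))
      x y x y (A y)
  let dA : E →L[ℝ] E := fderiv ℝ Acoord (extChartAt 𝓘(ℝ, E) x x) v
  (show TangentSpace 𝓘(ℝ, E) x →L[ℝ] TangentSpace 𝓘(ℝ, E) x from dA) + christoffelAt x v ∘L A x - A x ∘L christoffelAt x v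

/-- Riemannian gradient. -/
def grad (f : M → ℝ) (x : M) : TangentSpace 𝓘(ℝ, E) x :=
  let df : TangentSpace 𝓘(ℝ, E) x →L[ℝ] ℝ := mfderiv 𝓘(ℝ, E) 𝓘(ℝ, ℝ) f x
  (InnerProductSpace.toDual ℝ (TangentSpace 𝓘(ℝ, E) x)).symm df

/-- Riemannian Hessian: the covariant derivative of the gradient vector field. -/
def hess (f : M → ℝ) (x : M) : TangentSpace 𝓘(ℝ, E) x →L[ℝ] TangentSpace 𝓘(ℝ, E) x :=
  leviCivita (grad f) x

/-! ## Retractions -/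

/-- The restriction `R_x` of `R : TM → M` to the tangent space at `x`. -/
def retrAt (R : TangentBundle 𝓘(ℝ, E) M → M) (x : M) (s : TangentSpace 𝓘(ℝ, E) x) : M := R ⟨x, s⟩

/-- The differential `T_s = D R_x(s)`, a linear map from `T_x M` to the tangent space at
`R_x(s)`. -/
def diffRetr (R : TangentBundle 𝓘(ℝ, E) M → M) (x : M) (s : TangentSpace 𝓘(ℝ, E) x) :
    TangentSpace 𝓘(ℝ, E) x →L[ℝ] TangentSpace 𝓘(ℝ, E) (retrAt R x s) :=
  mfderiv 𝓘(ℝ, TangentSpace 𝓘(ℝ, E) x) 𝓘(ℝ, E) (retrAt R x) s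

/-- A retraction: a smooth map `R : TM → M` with `R_x(0) = x` and `D R_x(0) = id`. The second
property is an equality in the tangent bundle, since `D R_x(0)` has values in the tangent space
at `R_x(0)`, which is not the same type as the tangent space at `x`. -/
structure IsRetraction (R : TangentBundle 𝓘(ℝ, E) M → M) : Prop where
  smooth : ContMDiff 𝓘(ℝ, E).tangent 𝓘(ℝ, E) ∞ R
  zero : ∀ x : M, retrAt R x 0 = x
  diff_zero : ∀ (x : M) (s : TangentSpace 𝓘(ℝ, E) x),
    (⟨retrAt R x 0, diffRetr R x 0 s⟩ : TangentBundle 𝓘(ℝ, E) M) = ⟨x, s⟩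

/-- `R` is second-order nice on the subset `S` of the tangent bundle, with constants
`c₁, c₂, c₃`. -/
def SecondOrderNiceWith (R : TangentBundle 𝓘(ℝ, E) M → M) (S : Set (TangentBundle 𝓘(ℝ, E) M))
    (c₁ c₂ c₃ : ℝ) : Prop :=
  ∀ (x : M) (s : TangentSpace 𝓘(ℝ, E) x), (⟨x, s⟩ : TangentBundle 𝓘(ℝ, E) M) ∈ S →
    ∀ u : TangentSpace 𝓘(ℝ, E) x,
      (∀ t ∈ Set.Icc (0 : ℝ) 1, ‖diffRetr R x (t • s)‖ ≤ c₁) ∧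
      (∀ t ∈ Set.Icc (0 : ℝ) 1,
        ‖covDerivAlong (E := E) (fun τ => retrAt R x (τ • s)) (fun τ => diffRetr R x (τ • s) u) t‖
          ≤ c₂ * ‖s‖ * ‖u‖) ∧
      ‖acceleration (E := E) (fun τ => retrAt R x (s + τ • u)) 0‖ ≤ c₃ * ‖s‖ * ‖u‖ ^ 2

/-- `R` is second-order nice on `S`. -/
def SecondOrderNice (R : TangentBundle 𝓘(ℝ, E) M → M) (S : Set (TangentBundle 𝓘(ℝ, E) M)) : Prop :=
  ∃ c₁ c₂ c₃ : ℝ, SecondOrderNiceWith R S c₁ c₂ c₃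

/-- The pullback `f ∘ R_x`, a real function on the inner product space `T_x M`. Its gradient
`∇` and its Hessian, the derivative of the gradient, are the ones of that inner product space. -/
def pullback (f : M → ℝ) (R : TangentBundle 𝓘(ℝ, E) M → M) (x : M)
    (s : TangentSpace 𝓘(ℝ, E) x) : ℝ := f (retrAt R x s)

/-- Hessian of a function on the tangent space at `x`. -/
def tangentHess {x : M} (h : TangentSpace 𝓘(ℝ, E) x → ℝ) (s : TangentSpace 𝓘(ℝ, E) x) :
    TangentSpace 𝓘(ℝ, E) x →L[ℝ] TangentSpace 𝓘(ℝ, E) x :=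
  fderiv ℝ (∇ h) s

/-- Second-order Taylor expansion of the pullback at the origin of `T_x M`. -/
def taylorTwo (f : M → ℝ) (R : TangentBundle 𝓘(ℝ, E) M → M) (x : M)
    (s : TangentSpace 𝓘(ℝ, E) x) : ℝ :=
  pullback f R x 0 + inner ℝ s (∇ (pullback f R x) 0)
    + (1 / 2) * inner ℝ s (tangentHess (pullback f R x) 0 s)

/-- The cubically regularized model `m` on `T_x M`, with regularization parameter `σ`. -/
def model (f : M → ℝ) (R : TangentBundle 𝓘(ℝ, E) M → M) (x : M) (σ : ℝ)
    (s : TangentSpace 𝓘(ℝ, E) x) : ℝ :=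
  taylorTwo f R x s + σ / 3 * ‖s‖ ^ 3

/-- The regularized ratio `ρ` of actual over model improvement. -/
def ratio (f : M → ℝ) (R : TangentBundle 𝓘(ℝ, E) M → M) (x : M) (σ : ℝ)
    (s : TangentSpace 𝓘(ℝ, E) x) : ℝ :=
  (f x - f (retrAt R x s)) /
    (model f R x σ 0 - model f R x σ s + σ / 3 * ‖s‖ ^ 3)

/-! ## Adaptive regularization with cubics -/

/-- Parameters of the algorithm. -/
structure ARCParams where
  θ : ℝ
  σmin : ℝ
  η₁ : ℝ
  η₂ : ℝ
  γ₁ : ℝ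
  γ₂ : ℝ
  γ₃ : ℝ
  θ_pos : 0 < θ
  σmin_pos : 0 < σmin
  η₁_pos : 0 < η₁
  η₁_le_η₂ : η₁ ≤ η₂
  η₂_lt_one : η₂ < 1
  γ₁_pos : 0 < γ₁
  γ₁_lt_one : γ₁ < 1
  one_lt_γ₂ : 1 < γ₂
  γ₂_lt_γ₃ : γ₂ < γ₃

/-- Iteration `k` is reached: the algorithm has not terminated before, that is, no earlier step
is zero. -/
def Reached {x : ℕ → M} (s : ∀ k, TangentSpace 𝓘(ℝ, E) (x k)) (k : ℕ) : Prop :=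
  ∀ j < k, s j ≠ 0

/-- `x`, `s`, `σ` are the iterates, trial steps and regularization parameters of a run of the
algorithm on `f` with retraction `R`. If the algorithm terminates, with a zero step, the entries of
the sequences for the later iterations, which are not reached, are unconstrained. The steps may
or may not satisfy further conditions, such as second-order progress. -/
structure IsARCRun (P : ARCParams) (f : M → ℝ) (R : TangentBundle 𝓘(ℝ, E) M → M)
    (x : ℕ → M) (s : ∀ k, TangentSpace 𝓘(ℝ, E) (x k)) (σ : ℕ → ℝ) : Prop where
  σ_zero : P.σmin ≤ σ 0
  model_le : ∀ k, Reached s k → model f R (x k) (σ k) (s k) ≤ model f R (x k) (σ k) 0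
  grad_model_le : ∀ k, Reached s k → ‖∇ (model f R (x k) (σ k)) (s k)‖ ≤ P.θ * ‖s k‖ ^ 2
  accept : ∀ k, Reached s (k + 1) → P.η₁ ≤ ratio f R (x k) (σ k) (s k) →
    x (k + 1) = retrAt R (x k) (s k)
  reject : ∀ k, Reached s (k + 1) → ratio f R (x k) (σ k) (s k) < P.η₁ → x (k + 1) = x k
  very_successful : ∀ k, Reached s (k + 1) → P.η₂ ≤ ratio f R (x k) (σ k) (s k) →
    σ (k + 1) ∈ Set.Icc (max P.σmin (P.γ₁ * σ k)) (σ k)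
  successful : ∀ k, Reached s (k + 1) → P.η₁ ≤ ratio f R (x k) (σ k) (s k) →
    ratio f R (x k) (σ k) (s k) < P.η₂ → σ (k + 1) ∈ Set.Icc (σ k) (P.γ₂ * σ k)
  unsuccessful : ∀ k, Reached s (k + 1) → ratio f R (x k) (σ k) (s k) < P.η₁ →
    σ (k + 1) ∈ Set.Icc (P.γ₂ * σ k) (P.γ₃ * σ k)

/-- Iteration `k` is successful: it is reached, does not terminate the algorithm, and its step is
accepted. -/
def Successful (P : ARCParams) (f : M → ℝ) (R : TangentBundle 𝓘(ℝ, E) M → M)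
    {x : ℕ → M} (s : ∀ k, TangentSpace 𝓘(ℝ, E) (x k)) (σ : ℕ → ℝ) (k : ℕ) : Prop :=
  Reached s (k + 1) ∧ P.η₁ ≤ ratio f R (x k) (σ k) (s k)

/-- The set `{(x₀, s₀), (x₁, s₁), …}` of points and steps generated by the algorithm. -/
def pointsAndSteps {x : ℕ → M} (s : ∀ k, TangentSpace 𝓘(ℝ, E) (x k)) :
    Set (TangentBundle 𝓘(ℝ, E) M) :=
  {p | ∃ k, Reached s k ∧ p = ⟨x k, s k⟩}

/-- The points and partial steps `(x_k, t s_k)`, `0 ≤ t ≤ 1`. -/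
def pointsAndPartialSteps {x : ℕ → M} (s : ∀ k, TangentSpace 𝓘(ℝ, E) (x k)) :
    Set (TangentBundle 𝓘(ℝ, E) M) :=
  {p | ∃ k, Reached s k ∧ ∃ t ∈ Set.Icc (0 : ℝ) 1, p = ⟨x k, t • s k⟩}

/-- The union of all the curves `{R_{x_k}(t s_k) : 0 ≤ t ≤ 1}` of retracted steps. -/
def retractedSteps (R : TangentBundle 𝓘(ℝ, E) M → M)
    {x : ℕ → M} (s : ∀ k, TangentSpace 𝓘(ℝ, E) (x k)) : Set M :=
  R '' pointsAndPartialSteps s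

/-- The iterates generated by the algorithm. -/
def iterates {x : ℕ → M} (s : ∀ k, TangentSpace 𝓘(ℝ, E) (x k)) : Set M :=
  {y | ∃ k, Reached s k ∧ y = x k}

/-- First regularity assumption, with constant `L`: `f` is `C²` and the second-order Taylor
expansions of the pullbacks are accurate from above, at each iteration. -/
def ScalarRegularity (f : M → ℝ) (R : TangentBundle 𝓘(ℝ, E) M → M)
    {x : ℕ → M} (s : ∀ k, TangentSpace 𝓘(ℝ, E) (x k)) (L : ℝ) : Prop :=
  ContMDiff 𝓘(ℝ, E) 𝓘(ℝ, ℝ) 2 f ∧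
  ∀ k, Reached s k →
    pullback f R (x k) (s k) - taylorTwo f R (x k) (s k) ≤ L / 6 * ‖s k‖ ^ 3

/-- Second regularity assumption, with constant `L'` and function `q`: first-order Taylor
expansions of the gradients of the pullbacks are accurate, at each successful iteration. -/
def VectorRegularity (P : ARCParams) (f : M → ℝ) (R : TangentBundle 𝓘(ℝ, E) M → M)
    {x : ℕ → M} (s : ∀ k, TangentSpace 𝓘(ℝ, E) (x k)) (σ : ℕ → ℝ) (L' : ℝ)
    (q : ℝ≥0 → ℝ≥0) : Prop :=
  Continuous q ∧ q 0 = 0 ∧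
  ∀ k, Successful P f R s σ k →
    ‖∇ (pullback f R (x k)) (s k) - ∇ (pullback f R (x k)) 0
        - tangentHess (pullback f R (x k)) 0 (s k)‖
      ≤ L' / 2 * ‖s k‖ ^ 2 + q ‖s k‖₊ * ‖grad (E := E) f (retrAt R (x k) (s k))‖

end Geometry

end ManifoldARC

end

set_option linter.unusedSectionVars false

noncomputable section

namespace ManifoldARC

/-! ### Christoffel symbols under a change of coordinates. -/

section Christoffel

variable {E : Type*} [NormedAddCommGroup E] [NormedSpace ℝ E]

/-! Everything reduces to one estimate on the pullback `h = f ∘ R_x`, namely `‖∇²h(t s) - ∇²h(0)‖ ≤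
L t ‖s‖` for `t ∈ [0, 1]`. Integrating it once along the ray gives the gradient expansion with `q =
0`, and integrating again gives the scalar expansion, with the same `L`
(`regularity_of_norm_tangentHess_sub_le`).

Existence of some `L` is a compactness argument. The inequality `m(s) ≤ m(0)` together with `σ ≥
σmin` bounds the steps, because the cubic term beats the quadratic part of the model, whose
coefficients are bounded over a compact set of base points. Tangent vectors of bounded norm over a
compact set are locally covered by compact sets of coordinates, so the third derivatives of the
pullbacks are uniformly bounded there (`exists_norm_iteratedFDeriv_pullback_le`), and the retracted
steps stay in a compact set.

For the explicit `L`, differentiating `⟨∇h, u⟩` gives `⟨∇²h(s)u, u⟩ = ⟨Hess f [T_s u], T_s u⟩ +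
⟨grad f, c''(0)⟩` (`inner_tangentHess_pullback`). Along `t ↦ R_x(t s)` the first term has derivative
`⟨(∇_{c'} Hess f) U, U⟩ + ⟨Hess f [DU/dt], U⟩ + ⟨Hess f [U], DU/dt⟩`, at most `(c₁³ J + 2 c₁ c₂ H)
‖s‖ ‖u‖²`. The second is at most `c₃ G t ‖s‖ ‖u‖²`, and vanishes at `t = 0`. Since `∇²h` is
symmetric, the bound on the quadratic form is a bound on the operator norm.

Connection and Hessian at a point are defined in the chart centred at that very point. To
differentiate the Hessian, or to see that it is continuous, its expression in one fixed chart is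
needed; this comes from the transformation law `christoffel_comp`. The maxima `G`, `H`, `J` exist
because the fibrewise norms are upper semicontinuous. -/

theorem christoffelFirst_apply (G : E → E →L[ℝ] E →L[ℝ] ℝ) (z u v w : E) :
    christoffelFirst G z u v w =
      1 / 2 * (fderiv ℝ G z u v w + fderiv ℝ G z v u w - fderiv ℝ G z w u v) := by
  simp [christoffelFirst]

theorem apply_christoffel {G : E → E →L[ℝ] E →L[ℝ] ℝ} {z : E} (hG : (G z).IsInvertible)
    (u v w : E) : G z (christoffel G z u v) w = christoffelFirst G z u v w := by
  obtain ⟨e, he⟩ := hG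
  simp only [christoffel, ContinuousLinearMap.comp_apply, ContinuousLinearMap.compL_apply]
  rw [← he, ContinuousLinearMap.inverse_equiv]
  simp

theorem fderiv_apply_apply {G : E → E →L[ℝ] E →L[ℝ] ℝ} {z : E} (hG : DifferentiableAt ℝ G z)
    (u v w : E) : fderiv ℝ (fun y => G y v w) z u = fderiv ℝ G z u v w := by
  have h := ((hG.hasFDerivAt.clm_apply (hasFDerivAt_const v z)).clm_apply (hasFDerivAt_const w z))
  rw [h.fderiv]
  simp

/-- Chain and product rules for a pulled-back metric; the last two terms come from differentiating
`ψ'` in each slot. -/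
theorem fderiv_metric_comp {G G' : E → E →L[ℝ] E →L[ℝ] ℝ} {ψ : E → E} {ψ' : E → E →L[ℝ] E}
    {ψ'' : E →L[ℝ] E →L[ℝ] E} {z : E} (hψ : HasFDerivAt ψ (ψ' z) z) (hψ' : HasFDerivAt ψ' ψ'' z)
    (hG : DifferentiableAt ℝ G z) (hG' : DifferentiableAt ℝ G' (ψ z))
    (heq : ∀ᶠ y in nhds z, ∀ v w, G y v w = G' (ψ y) (ψ' y v) (ψ' y w)) (u v w : E) :
    fderiv ℝ G z u v w = fderiv ℝ G' (ψ z) (ψ' z u) (ψ' z v) (ψ' z w)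
      + G' (ψ z) (ψ'' u v) (ψ' z w) + G' (ψ z) (ψ' z v) (ψ'' u w) := by
  rw [← fderiv_apply_apply hG]
  have h1 : (fun y => G y v w) =ᶠ[nhds z] fun y => G' (ψ y) (ψ' y v) (ψ' y w) :=
    heq.mono fun y hy => hy v w
  rw [h1.fderiv_eq]
  have h2 := (((hG'.hasFDerivAt.comp z hψ).clm_apply
    (hψ'.clm_apply (hasFDerivAt_const v z))).clm_apply (hψ'.clm_apply (hasFDerivAt_const w z)))
  have h3 : HasFDerivAt (fun y => G' (ψ y) (ψ' y v) (ψ' y w)) _ z := h2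
  rw [h3.fderiv]
  simp
  ring

/-- In the Koszul combination of the three derivatives of `G`, the symmetry of `ψ''` and of `G'`
cancels all the second-order terms except `G' (ψ'' u v) (ψ' w)`. Nondegeneracy of `G'` and
surjectivity of `ψ'` then remove the test vector `w`. -/
theorem christoffel_comp {G G' : E → E →L[ℝ] E →L[ℝ] ℝ} {ψ : E → E} {ψ' : E → E →L[ℝ] E}
    {ψ'' : E →L[ℝ] E →L[ℝ] E} {z : E} (hψ : ∀ᶠ y in nhds z, HasFDerivAt ψ (ψ' y) y)
    (hψ' : HasFDerivAt ψ' ψ'' z) (hsurj : Function.Surjective (ψ' z))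
    (hG : DifferentiableAt ℝ G z) (hG' : DifferentiableAt ℝ G' (ψ z))
    (hinv : (G z).IsInvertible) (hinv' : (G' (ψ z)).IsInvertible)
    (hsymm : ∀ u v, G' (ψ z) u v = G' (ψ z) v u)
    (heq : ∀ᶠ y in nhds z, ∀ v w, G y v w = G' (ψ y) (ψ' y v) (ψ' y w)) (u v : E) :
    ψ' z (christoffel G z u v) = christoffel G' (ψ z) (ψ' z u) (ψ' z v) + ψ'' u v := by
  have hs : ∀ a b, ψ'' a b = ψ'' b a := fun a b =>
    second_derivative_symmetric_of_eventually hψ hψ' a b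
  have hinj : Function.Injective (G' (ψ z)) := by
    obtain ⟨e, he⟩ := hinv'
    rw [← he]
    exact e.injective
  apply hinj
  ext w'
  obtain ⟨w, rfl⟩ := hsurj w'
  rw [← heq.self_of_nhds, apply_christoffel hinv, map_add, add_apply,
    apply_christoffel hinv', christoffelFirst_apply, christoffelFirst_apply]
  have h := fderiv_metric_comp hψ.self_of_nhds hψ' hG hG' heq
  rw [h u v w, h v u w, h w u v, hs v u, hs w u, hs w v, hsymm (ψ' z u) (ψ'' v w),
    hsymm (ψ' z v) (ψ'' u w)]
  ring

/-- Transformation law of the covariant derivative of a vector field under a change of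
coordinates `ψ`. -/
theorem covDeriv_comp {G G' : E → E →L[ℝ] E →L[ℝ] ℝ} {ψ : E → E} {ψ' : E → E →L[ℝ] E}
    {ψ'' : E →L[ℝ] E →L[ℝ] E} {z : E} (hψ : ∀ᶠ y in nhds z, HasFDerivAt ψ (ψ' y) y)
    (hψ' : HasFDerivAt ψ' ψ'' z) (hsurj : Function.Surjective (ψ' z))
    (hG : DifferentiableAt ℝ G z) (hG' : DifferentiableAt ℝ G' (ψ z))
    (hinv : (G z).IsInvertible) (hinv' : (G' (ψ z)).IsInvertible)
    (hsymm : ∀ u v, G' (ψ z) u v = G' (ψ z) v u)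
    (heq : ∀ᶠ y in nhds z, ∀ v w, G y v w = G' (ψ y) (ψ' y v) (ψ' y w))
    {X X' : E → E} (hX : DifferentiableAt ℝ X z) (hX' : DifferentiableAt ℝ X' (ψ z))
    (hXeq : ∀ᶠ y in nhds z, X' (ψ y) = ψ' y (X y)) (v : E) :
    ψ' z (fderiv ℝ X z v + christoffel G z v (X z)) =
      fderiv ℝ X' (ψ z) (ψ' z v) + christoffel G' (ψ z) (ψ' z v) (X' (ψ z)) := by
  have h1 : HasFDerivAt (fun y => X' (ψ y)) _ z := hX'.hasFDerivAt.comp z hψ.self_of_nhds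
  have h2 := (hψ'.clm_apply hX.hasFDerivAt)
  have h3 := congrArg (fun L => L v) (h1.unique (h2.congr_of_eventuallyEq hXeq))
  simp only [ContinuousLinearMap.comp_apply, add_apply,
    ContinuousLinearMap.flip_apply] at h3
  rw [map_add, christoffel_comp hψ hψ' hsurj hG hG' hinv hinv' hsymm heq, h3,
    hXeq.self_of_nhds]
  abel

end Christoffel

end ManifoldARC

namespace ManifoldARC

/-! ### Tangent vectors and the metric in charts. -/

section Coordinates

variable {E : Type*} [NormedAddCommGroup E] [NormedSpace ℝ E] [FiniteDimensional ℝ E]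
  {M : Type*} [TopologicalSpace M] [ChartedSpace E M] [IsManifold 𝓘(ℝ, E) ∞ M]
  [RiemannianBundle (fun x : M => TangentSpace 𝓘(ℝ, E) x)]

/-- The coordinates, in the chart at `x`, of tangent vectors at `y`. -/
def toCoord (x y : M) : TangentSpace 𝓘(ℝ, E) y →L[ℝ] E :=
  (trivializationAt E (TangentSpace 𝓘(ℝ, E)) x).continuousLinearMapAt ℝ y

/-- The tangent vector at `y` with given coordinates in the chart at `x`. -/
def ofCoord (x y : M) : E →L[ℝ] TangentSpace 𝓘(ℝ, E) y :=
  (trivializationAt E (TangentSpace 𝓘(ℝ, E)) x).symmL ℝ y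

theorem toCoord_ofCoord {x y : M} (hy : y ∈ (chartAt E x).source) (w : E) :
    toCoord x y (ofCoord x y w) = w :=
  (trivializationAt E (TangentSpace 𝓘(ℝ, E)) x).continuousLinearMapAt_symmL hy w

theorem ofCoord_toCoord {x y : M} (hy : y ∈ (chartAt E x).source) (w : TangentSpace 𝓘(ℝ, E) y) :
    ofCoord x y (toCoord x y w) = w :=
  (trivializationAt E (TangentSpace 𝓘(ℝ, E)) x).symmL_continuousLinearMapAt hy w

theorem trivializationAt_snd {x y : M} (hy : y ∈ (chartAt E x).source)
    (w : TangentSpace 𝓘(ℝ, E) y) :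
    (trivializationAt E (TangentSpace 𝓘(ℝ, E)) x ⟨y, w⟩).2 = toCoord x y w :=
  (congrFun ((trivializationAt E (TangentSpace 𝓘(ℝ, E)) x).coe_linearMapAt_of_mem
    (R := ℝ) hy) w).symm

theorem toCoord_self (x : M) (w : TangentSpace 𝓘(ℝ, E) x) : toCoord x x w = w := by
  refine (congrArg (fun L => L w) (TangentBundle.continuousLinearMapAt_trivializationAt_eq_core
    (I := 𝓘(ℝ, E)) (M := M) (b := x) (b₀ := x) (mem_chart_source E x))).trans ?_
  exact (tangentBundleCore 𝓘(ℝ, E) M).coordChange_self (achart E x) x (mem_chart_source E x) w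

theorem symm_mem_source {x : M} {z : E} (hz : z ∈ (extChartAt 𝓘(ℝ, E) x).target) :
    (extChartAt 𝓘(ℝ, E) x).symm z ∈ (chartAt E x).source := by
  rw [← extChartAt_source 𝓘(ℝ, E)]
  exact (extChartAt 𝓘(ℝ, E) x).map_target hz

theorem extChartAt_mem_target {x y : M} (hy : y ∈ (chartAt E x).source) :
    extChartAt 𝓘(ℝ, E) x y ∈ (extChartAt 𝓘(ℝ, E) x).target := by
  rw [← extChartAt_source 𝓘(ℝ, E)] at hy
  exact (extChartAt 𝓘(ℝ, E) x).map_source hy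

theorem extChartAt_symm_extChartAt {x y : M} (hy : y ∈ (chartAt E x).source) :
    (extChartAt 𝓘(ℝ, E) x).symm (extChartAt 𝓘(ℝ, E) x y) = y := by
  rw [← extChartAt_source 𝓘(ℝ, E)] at hy
  exact (extChartAt 𝓘(ℝ, E) x).left_inv hy

theorem target_mem_nhds {x : M} {z : E} (hz : z ∈ (extChartAt 𝓘(ℝ, E) x).target) :
    (extChartAt 𝓘(ℝ, E) x).target ∈ nhds z :=
  (isOpen_extChartAt_target x).mem_nhds hz

theorem vectorFieldCoord_eq (X : ∀ y : M, TangentSpace 𝓘(ℝ, E) y) {x : M} {z : E}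
    (hz : z ∈ (extChartAt 𝓘(ℝ, E) x).target) :
    vectorFieldCoord X x z =
      toCoord x ((extChartAt 𝓘(ℝ, E) x).symm z) (X ((extChartAt 𝓘(ℝ, E) x).symm z)) :=
  trivializationAt_snd (symm_mem_source hz) _

theorem vectorFieldCoord_extChartAt (X : ∀ y : M, TangentSpace 𝓘(ℝ, E) y) {x y : M}
    (hy : y ∈ (chartAt E x).source) :
    vectorFieldCoord X x (extChartAt 𝓘(ℝ, E) x y) = toCoord x y (X y) := by
  rw [vectorFieldCoord_eq X (extChartAt_mem_target hy), extChartAt_symm_extChartAt hy]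

theorem metricCoord_apply (x : M) (z u v : E) : metricCoord x z u v =
    inner ℝ (ofCoord x ((extChartAt 𝓘(ℝ, E) x).symm z) u)
      (ofCoord x ((extChartAt 𝓘(ℝ, E) x).symm z) v) := rfl

theorem metricCoord_extChartAt {x y : M} (hy : y ∈ (chartAt E x).source)
    (u v : TangentSpace 𝓘(ℝ, E) y) :
    metricCoord x (extChartAt 𝓘(ℝ, E) x y) (toCoord x y u) (toCoord x y v) = inner ℝ u v := by
  rw [metricCoord_apply, extChartAt_symm_extChartAt hy, ofCoord_toCoord hy, ofCoord_toCoord hy]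

theorem metricCoord_symm (x : M) (z u v : E) : metricCoord x z u v = metricCoord x z v u := by
  rw [metricCoord_apply, metricCoord_apply, real_inner_comm]

/-- Positive definiteness gives injectivity into the dual, which has the same dimension. -/
theorem metricCoord_isInvertible {x : M} {z : E} (hz : z ∈ (extChartAt 𝓘(ℝ, E) x).target) :
    (metricCoord x z).IsInvertible := by
  have hinj : Function.Injective (metricCoord x z).toLinearMap := by
    rw [← LinearMap.ker_eq_bot, LinearMap.ker_eq_bot']
    intro a ha
    have h1 : metricCoord x z a a = 0 := congrArg (fun L => L a) ha
    rw [metricCoord_apply] at h1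
    rw [← toCoord_ofCoord (symm_mem_source hz) a, inner_self_eq_zero.mp h1, map_zero]
  have hd : Module.finrank ℝ E = Module.finrank ℝ (E →L[ℝ] ℝ) := by
    rw [← (LinearMap.toContinuousLinearMap (𝕜 := ℝ) (E := E) (F' := ℝ)).finrank_eq]
    exact Subspace.dual_finrank_eq.symm
  exact ⟨(LinearEquiv.ofInjectiveOfFinrankEq _ hinj hd).toContinuousLinearEquiv, by ext; rfl⟩

theorem toCoord_eq_tangentCoordChange {x y : M} (hy : y ∈ (chartAt E x).source)
    (v : TangentSpace 𝓘(ℝ, E) y) :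
    toCoord x y v = tangentCoordChange 𝓘(ℝ, E) y x y v :=
  congrArg (fun L => L v) (TangentBundle.continuousLinearMapAt_trivializationAt_eq_core
    (I := 𝓘(ℝ, E)) (M := M) (b := y) (b₀ := x) hy)

/-- Cocycle identity of the tangent bundle, passing through the chart centred at `p`. -/
theorem toCoord_eq_fderiv {x y p : M} (hx : p ∈ (chartAt E x).source)
    (hy : p ∈ (chartAt E y).source) (v : TangentSpace 𝓘(ℝ, E) p) :
    toCoord y p v = fderiv ℝ (extChartAt 𝓘(ℝ, E) y ∘ (extChartAt 𝓘(ℝ, E) x).symm)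
      (extChartAt 𝓘(ℝ, E) x p) (toCoord x p v) := by
  rw [toCoord_eq_tangentCoordChange hx, toCoord_eq_tangentCoordChange hy]
  have h : tangentCoordChange 𝓘(ℝ, E) x y p =
      fderiv ℝ (extChartAt 𝓘(ℝ, E) y ∘ (extChartAt 𝓘(ℝ, E) x).symm) (extChartAt 𝓘(ℝ, E) x p) := by
    rw [tangentCoordChange_def, ModelWithCorners.range_eq_univ, fderivWithin_univ]
  rw [← h]
  refine (tangentCoordChange_comp ?_).symm
  simp only [extChartAt_source]
  exact ⟨⟨mem_chart_source E p, hx⟩, hy⟩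

theorem contDiffAt_coordChange {x y p : M} (hx : p ∈ (chartAt E x).source)
    (hy : p ∈ (chartAt E y).source) :
    ContDiffAt ℝ ∞ (extChartAt 𝓘(ℝ, E) y ∘ (extChartAt 𝓘(ℝ, E) x).symm)
      (extChartAt 𝓘(ℝ, E) x p) := by
  have h' : extChartAt 𝓘(ℝ, E) x p ∈
      ((extChartAt 𝓘(ℝ, E) x).symm ≫ extChartAt 𝓘(ℝ, E) y).source := by
    rw [PartialEquiv.trans_source'', PartialEquiv.symm_symm, PartialEquiv.symm_target]
    refine Set.mem_image_of_mem _ ?_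
    simp only [extChartAt_source]
    exact ⟨hx, hy⟩
  have h := contDiffWithinAt_ext_coord_change (I := 𝓘(ℝ, E)) (n := ∞) y x h'
  rwa [ModelWithCorners.range_eq_univ, contDiffWithinAt_univ] at h

theorem eventually_symm_mem_source {x p : M} (hx : p ∈ (chartAt E x).source) {s : Set M}
    (hs : s ∈ nhds p) :
    ∀ᶠ z in nhds (extChartAt 𝓘(ℝ, E) x p), (extChartAt 𝓘(ℝ, E) x).symm z ∈ s := by
  have h := continuousAt_extChartAt_symm'' (I := 𝓘(ℝ, E)) (extChartAt_mem_target hx)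
  rw [ContinuousAt, extChartAt_symm_extChartAt hx] at h
  exact h hs

theorem isContinuousRiemannianBundle_tangentSpace
    [h : IsContMDiffRiemannianBundle 𝓘(ℝ, E) ∞ E (fun x : M => TangentSpace 𝓘(ℝ, E) x)] :
    IsContinuousRiemannianBundle E (fun x : M => TangentSpace 𝓘(ℝ, E) x) := by
  obtain ⟨g, hg, h⟩ := h.exists_contMDiff
  exact ⟨g, hg.continuous, h⟩

/-- Each matrix entry is the inner product of two sections with constant coordinates, which are
smooth sections over the chart. -/
theorem contDiffOn_metricCoord
    [IsContMDiffRiemannianBundle 𝓘(ℝ, E) ∞ E (fun x : M => TangentSpace 𝓘(ℝ, E) x)] (x : M) :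
    ContDiffOn ℝ ∞ (metricCoord x) (extChartAt 𝓘(ℝ, E) x).target := by
  rw [contDiffOn_clm_apply]
  intro u
  rw [contDiffOn_clm_apply]
  intro v
  rw [← contMDiffOn_iff_contDiffOn]
  have key : ∀ u : E, ContMDiffOn 𝓘(ℝ, E) (𝓘(ℝ, E).prod 𝓘(ℝ, E)) ∞
      (fun z => (⟨(extChartAt 𝓘(ℝ, E) x).symm z, ofCoord x ((extChartAt 𝓘(ℝ, E) x).symm z) u⟩ :
        TotalSpace E (TangentSpace 𝓘(ℝ, E) : M → Type _))) (extChartAt 𝓘(ℝ, E) x).target := by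
    intro u
    have h1 : ContMDiffOn 𝓘(ℝ, E) (𝓘(ℝ, E).prod 𝓘(ℝ, E)) ∞
        (fun z => ((extChartAt 𝓘(ℝ, E) x).symm z, u)) (extChartAt 𝓘(ℝ, E) x).target :=
      (contMDiffOn_extChartAt_symm x).prodMk contMDiffOn_const
    have h2 := ((trivializationAt E (TangentSpace 𝓘(ℝ, E)) x).contMDiffOn_symm
      (IB := 𝓘(ℝ, E)) (n := ∞)).comp h1 (fun z hz => by
        simpa [TangentBundle.trivializationAt_target] using symm_mem_source hz)
    refine h2.congr fun z hz => ?_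
    refine Eq.trans ?_ ((trivializationAt E (TangentSpace 𝓘(ℝ, E)) x).mk_symm
      (symm_mem_source hz) u)
    exact congrArg _ ((trivializationAt E (TangentSpace 𝓘(ℝ, E)) x).symmL_apply
      (symm_mem_source hz) u)
  exact ContMDiffOn.inner_bundle (E := fun y : M => TangentSpace 𝓘(ℝ, E) y) (key u) (key v)

end Coordinates

end ManifoldARC

namespace ManifoldARC

/-! ### Chart independence of the Levi-Civita connection. -/

section Connection

variable {E : Type*} [NormedAddCommGroup E] [NormedSpace ℝ E] [FiniteDimensional ℝ E]
  {M : Type*} [TopologicalSpace M] [ChartedSpace E M] [IsManifold 𝓘(ℝ, E) ∞ M]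
  [RiemannianBundle (fun x : M => TangentSpace 𝓘(ℝ, E) x)]

theorem vectorFieldCoord_coordChange (X : ∀ y : M, TangentSpace 𝓘(ℝ, E) y) {x y p : M}
    (hx : p ∈ (chartAt E x).source) (hy : p ∈ (chartAt E y).source) :
    ∀ᶠ z in nhds (extChartAt 𝓘(ℝ, E) x p),
      vectorFieldCoord X y ((extChartAt 𝓘(ℝ, E) y ∘ (extChartAt 𝓘(ℝ, E) x).symm) z) =
        fderiv ℝ (extChartAt 𝓘(ℝ, E) y ∘ (extChartAt 𝓘(ℝ, E) x).symm) z
          (vectorFieldCoord X x z) := by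
  filter_upwards [eventually_symm_mem_source hx ((chartAt E y).open_source.mem_nhds hy),
    target_mem_nhds (extChartAt_mem_target hx)] with z h1 hz
  have h2 := symm_mem_source hz
  rw [Function.comp_apply, vectorFieldCoord_extChartAt X h1, toCoord_eq_fderiv h2 h1,
    (extChartAt 𝓘(ℝ, E) x).right_inv hz, vectorFieldCoord_eq X hz]

theorem differentiableAt_vectorFieldCoord_coordChange (X : ∀ y : M, TangentSpace 𝓘(ℝ, E) y)
    {x y p : M} (hx : p ∈ (chartAt E x).source) (hy : p ∈ (chartAt E y).source)
    (hX : DifferentiableAt ℝ (vectorFieldCoord X x) (extChartAt 𝓘(ℝ, E) x p)) :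
    DifferentiableAt ℝ (vectorFieldCoord X y) (extChartAt 𝓘(ℝ, E) y p) := by
  have hχ := (contDiffAt_coordChange hy hx).differentiableAt (by simp)
  have hχp : (extChartAt 𝓘(ℝ, E) x ∘ (extChartAt 𝓘(ℝ, E) y).symm) (extChartAt 𝓘(ℝ, E) y p) =
      extChartAt 𝓘(ℝ, E) x p := by
    rw [Function.comp_apply, extChartAt_symm_extChartAt hy]
  have hψ' : DifferentiableAt ℝ (fderiv ℝ (extChartAt 𝓘(ℝ, E) y ∘ (extChartAt 𝓘(ℝ, E) x).symm))
      (extChartAt 𝓘(ℝ, E) x p) :=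
    ((contDiffAt_coordChange hx hy).fderiv_right (m := ∞) le_rfl).differentiableAt (by simp)
  have h1 := vectorFieldCoord_coordChange X hx hy
  -- The base point is rewritten as the image under the inverse change of charts, so that the
  -- coordinates in the chart at `y` become a composite with that map.
  rw [← hχp] at h1 hX hψ'
  have h2 := hχ.continuousAt.eventually h1
  refine (((hψ'.comp _ hχ).clm_apply (hX.comp _ hχ))).congr_of_eventuallyEq ?_
  filter_upwards [h2, target_mem_nhds (extChartAt_mem_target hy),
    eventually_symm_mem_source hy ((chartAt E x).open_source.mem_nhds hx)] with z h3 h4 h5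
  simp only [Function.comp_apply] at h3 ⊢
  rw [← h3, extChartAt_symm_extChartAt h5, (extChartAt 𝓘(ℝ, E) y).right_inv h4]

theorem metricCoord_coordChange {x y p : M} (hx : p ∈ (chartAt E x).source)
    (hy : p ∈ (chartAt E y).source) :
    ∀ᶠ z in nhds (extChartAt 𝓘(ℝ, E) x p), ∀ u v,
      metricCoord x z u v =
        metricCoord y ((extChartAt 𝓘(ℝ, E) y ∘ (extChartAt 𝓘(ℝ, E) x).symm) z)
          (fderiv ℝ (extChartAt 𝓘(ℝ, E) y ∘ (extChartAt 𝓘(ℝ, E) x).symm) z u)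
          (fderiv ℝ (extChartAt 𝓘(ℝ, E) y ∘ (extChartAt 𝓘(ℝ, E) x).symm) z v) := by
  filter_upwards [eventually_symm_mem_source hx ((chartAt E y).open_source.mem_nhds hy),
    target_mem_nhds (extChartAt_mem_target hx)] with z h1 hz u v
  have h2 := symm_mem_source hz
  have h3 : ∀ w, fderiv ℝ (extChartAt 𝓘(ℝ, E) y ∘ (extChartAt 𝓘(ℝ, E) x).symm) z w =
      toCoord y _ (ofCoord x ((extChartAt 𝓘(ℝ, E) x).symm z) w) := by
    intro w
    rw [toCoord_eq_fderiv h2 h1, toCoord_ofCoord h2, (extChartAt 𝓘(ℝ, E) x).right_inv hz]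
  rw [h3, h3, Function.comp_apply, metricCoord_extChartAt h1, metricCoord_apply]

theorem leviCivita_apply (X : ∀ y : M, TangentSpace 𝓘(ℝ, E) y) (y : M)
    (v : TangentSpace 𝓘(ℝ, E) y) :
    toCoord y y (leviCivita X y v) =
      fderiv ℝ (vectorFieldCoord X y) (extChartAt 𝓘(ℝ, E) y y) (toCoord y y v) +
        christoffel (metricCoord y) (extChartAt 𝓘(ℝ, E) y y) (toCoord y y v)
          (toCoord y y (X y)) := by
  refine (toCoord_self y _).trans ?_
  rw [toCoord_self, toCoord_self]
  rfl

variable [IsContMDiffRiemannianBundle 𝓘(ℝ, E) ∞ E (fun x : M => TangentSpace 𝓘(ℝ, E) x)]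

theorem contDiffAt_metricCoord {x p : M} (hx : p ∈ (chartAt E x).source) :
    ContDiffAt ℝ ∞ (metricCoord x) (extChartAt 𝓘(ℝ, E) x p) :=
  (contDiffOn_metricCoord x).contDiffAt (target_mem_nhds (extChartAt_mem_target hx))

/-- The Levi-Civita connection is given by the same formula in all charts. -/
theorem toCoord_leviCivita (X : ∀ y : M, TangentSpace 𝓘(ℝ, E) y) {x y : M}
    (hx : y ∈ (chartAt E x).source)
    (hX : DifferentiableAt ℝ (vectorFieldCoord X x) (extChartAt 𝓘(ℝ, E) x y))
    (v : TangentSpace 𝓘(ℝ, E) y) :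
    toCoord x y (leviCivita X y v) =
      fderiv ℝ (vectorFieldCoord X x) (extChartAt 𝓘(ℝ, E) x y) (toCoord x y v) +
        christoffel (metricCoord x) (extChartAt 𝓘(ℝ, E) x y) (toCoord x y v)
          (toCoord x y (X y)) := by
  have hy := mem_chart_source E y
  set ψ := extChartAt 𝓘(ℝ, E) y ∘ (extChartAt 𝓘(ℝ, E) x).symm with hψdef
  have hψC := contDiffAt_coordChange hx hy
  have hψp : ψ (extChartAt 𝓘(ℝ, E) x y) = extChartAt 𝓘(ℝ, E) y y := by
    rw [hψdef, Function.comp_apply, extChartAt_symm_extChartAt hx]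
  have hψ : ∀ᶠ z in nhds (extChartAt 𝓘(ℝ, E) x y), HasFDerivAt ψ (fderiv ℝ ψ z) z :=
    ((hψC.of_le (m := 1) (by simp)).eventually (by simp)).mono
      fun z hz => (hz.differentiableAt (by simp)).hasFDerivAt
  have hψ' : HasFDerivAt (fderiv ℝ ψ) _ (extChartAt 𝓘(ℝ, E) x y) :=
    ((hψC.fderiv_right (m := ∞) le_rfl).differentiableAt (by simp)).hasFDerivAt
  have hval : ∀ w, fderiv ℝ ψ (extChartAt 𝓘(ℝ, E) x y) w = toCoord y y (ofCoord x y w) := by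
    intro w
    rw [toCoord_eq_fderiv hx hy, toCoord_ofCoord hx]
  have hsurj : Function.Surjective (fderiv ℝ ψ (extChartAt 𝓘(ℝ, E) x y)) := by
    intro w
    refine ⟨toCoord x y (ofCoord y y w), ?_⟩
    rw [hval, ofCoord_toCoord hx, toCoord_ofCoord hy]
  have hG := (contDiffAt_metricCoord hx).differentiableAt (by simp)
  have hG' : DifferentiableAt ℝ (metricCoord y) (ψ (extChartAt 𝓘(ℝ, E) x y)) := by
    rw [hψp]
    exact (contDiffAt_metricCoord hy).differentiableAt (by simp)
  have hX' : DifferentiableAt ℝ (vectorFieldCoord X y) (ψ (extChartAt 𝓘(ℝ, E) x y)) := by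
    rw [hψp]
    exact differentiableAt_vectorFieldCoord_coordChange X hx hy hX
  -- The definition of `leviCivita` at `y` uses the chart at `y`; the transformation law equates it
  -- with the image under `Dψ` of the formula in the chart at `x`, and `Dψ` is then undone.
  have key := covDeriv_comp hψ hψ' hsurj hG hG'
    (metricCoord_isInvertible (extChartAt_mem_target hx))
    (by rw [hψp]; exact metricCoord_isInvertible (extChartAt_mem_target hy))
    (metricCoord_symm y _) (metricCoord_coordChange hx hy) hX hX'
    (vectorFieldCoord_coordChange X hx hy) (toCoord x y v)
  rw [hψp, hval (toCoord x y v), ofCoord_toCoord hx, vectorFieldCoord_extChartAt X hx,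
    vectorFieldCoord_extChartAt X hy, ← leviCivita_apply X y v, hval] at key
  have key2 := congrArg (ofCoord y y) key
  rw [ofCoord_toCoord hy, ofCoord_toCoord hy] at key2
  rw [← key2, toCoord_ofCoord hx]

end Connection

end ManifoldARC

/-! ### Covariant derivative of endomorphism fields. -/

namespace ManifoldARC

/-- Inversion of continuous linear maps is smooth at invertible ones; the rest is linear algebra
applied to `G⁻¹` and `fderiv ℝ G`. -/
theorem contDiffAt_christoffel {E : Type*} [NormedAddCommGroup E] [NormedSpace ℝ E]
    [CompleteSpace E] {G : E → E →L[ℝ] E →L[ℝ] ℝ} {z : E} (hG : ContDiffAt ℝ ∞ G z)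
    (hinv : (G z).IsInvertible) : ContDiffAt ℝ ∞ (christoffel G) z := by
  have hd : ContDiffAt ℝ ∞ (fderiv ℝ G) z := hG.fderiv_right le_rfl
  have hflip : ContDiffAt ℝ ∞ (fun y => (fderiv ℝ G y).flip) z :=
    (ContinuousLinearMap.flipₗᵢ ℝ E E (E →L[ℝ] ℝ)).contDiff.contDiffAt.comp z hd
  have h1 : ContDiffAt ℝ ∞ (christoffelFirst G) z :=
    ((hd.add hflip).sub (contDiffAt_const.clm_comp hflip)).const_smul (1 / 2 : ℝ)
  have h2 : ContDiffAt ℝ ∞ (fun y => (G y).inverse) z := by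
    obtain ⟨e, he⟩ := hinv
    have h := contDiffAt_map_inverse (n := ∞) e
    rw [he] at h
    exact h.comp z hG
  exact ((ContinuousLinearMap.compL ℝ E (E →L[ℝ] ℝ) E).contDiff.contDiffAt.comp z h2).clm_comp h1

section Endomorphisms

variable {E : Type*} [NormedAddCommGroup E] [NormedSpace ℝ E] [FiniteDimensional ℝ E]
  {M : Type*} [TopologicalSpace M] [ChartedSpace E M] [IsManifold 𝓘(ℝ, E) ∞ M]
  [RiemannianBundle (fun x : M => TangentSpace 𝓘(ℝ, E) x)]

/-- A field of endomorphisms of the tangent spaces in the coordinates of the chart at `x`. -/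
def endCoord (A : ∀ y : M, TangentSpace 𝓘(ℝ, E) y →L[ℝ] TangentSpace 𝓘(ℝ, E) y) (x : M) (z : E) :
    E →L[ℝ] E :=
  (toCoord x ((extChartAt 𝓘(ℝ, E) x).symm z)) ∘L (A ((extChartAt 𝓘(ℝ, E) x).symm z)) ∘L
    (ofCoord x ((extChartAt 𝓘(ℝ, E) x).symm z))

theorem endCoord_apply (A : ∀ y : M, TangentSpace 𝓘(ℝ, E) y →L[ℝ] TangentSpace 𝓘(ℝ, E) y)
    (x : M) (z w : E) : endCoord A x z w =
      toCoord x ((extChartAt 𝓘(ℝ, E) x).symm z) (A ((extChartAt 𝓘(ℝ, E) x).symm z)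
        (ofCoord x ((extChartAt 𝓘(ℝ, E) x).symm z) w)) := rfl

theorem endCoord_extChartAt
    (A : ∀ y : M, TangentSpace 𝓘(ℝ, E) y →L[ℝ] TangentSpace 𝓘(ℝ, E) y) {x y : M}
    (hy : y ∈ (chartAt E x).source) (w : TangentSpace 𝓘(ℝ, E) y) :
    endCoord A x (extChartAt 𝓘(ℝ, E) x y) (toCoord x y w) = toCoord x y (A y w) := by
  rw [endCoord_apply, extChartAt_symm_extChartAt hy, ofCoord_toCoord hy]

theorem vectorFieldCoord_end_apply
    (A : ∀ y : M, TangentSpace 𝓘(ℝ, E) y →L[ℝ] TangentSpace 𝓘(ℝ, E) y)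
    (W : ∀ y : M, TangentSpace 𝓘(ℝ, E) y) {x : M} {z : E}
    (hz : z ∈ (extChartAt 𝓘(ℝ, E) x).target) :
    vectorFieldCoord (fun p => A p (W p)) x z = endCoord A x z (vectorFieldCoord W x z) := by
  rw [vectorFieldCoord_eq _ hz, vectorFieldCoord_eq _ hz, endCoord_apply,
    ofCoord_toCoord (symm_mem_source hz)]

/-- Here `toCoord y y` is the identity; inserting it puts every term in `E`, in the same shape as
the formula in an arbitrary chart. -/
theorem covDerivEnd_apply
    (A : ∀ y : M, TangentSpace 𝓘(ℝ, E) y →L[ℝ] TangentSpace 𝓘(ℝ, E) y) (y : M)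
    (v w : TangentSpace 𝓘(ℝ, E) y) :
    toCoord y y (covDerivEnd A y v w) =
      fderiv ℝ (endCoord A y) (extChartAt 𝓘(ℝ, E) y y) (toCoord y y v) (toCoord y y w)
      + christoffel (metricCoord y) (extChartAt 𝓘(ℝ, E) y y) (toCoord y y v) (toCoord y y (A y w))
      - toCoord y y (A y (ofCoord y y (christoffel (metricCoord y) (extChartAt 𝓘(ℝ, E) y y)
          (toCoord y y v) (toCoord y y w)))) := by
  have h : (fun z => ContinuousLinearMap.inCoordinates E (TangentSpace 𝓘(ℝ, E)) E
      (TangentSpace 𝓘(ℝ, E)) y ((extChartAt 𝓘(ℝ, E) y).symm z) y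
      ((extChartAt 𝓘(ℝ, E) y).symm z) (A ((extChartAt 𝓘(ℝ, E) y).symm z))) = endCoord A y := rfl
  have hself : ofCoord y y (christoffel (metricCoord y) (extChartAt 𝓘(ℝ, E) y y)
      (toCoord y y v) (toCoord y y w)) = christoffelAt y v w := by
    have h1 : christoffel (metricCoord y) (extChartAt 𝓘(ℝ, E) y y) (toCoord y y v) (toCoord y y w)
        = toCoord y y (christoffelAt y v w) := by
      rw [toCoord_self, toCoord_self]
      exact (toCoord_self y _).symm
    rw [h1, ofCoord_toCoord (mem_chart_source E y)]
  rw [hself, toCoord_self y v, toCoord_self y w]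
  refine (toCoord_self y _).trans ?_
  rw [← h]
  rw [toCoord_self y (A y w)]
  refine Eq.trans ?_ (congrArg _ (toCoord_self y (A y (christoffelAt y v w))).symm)
  rfl

/-- Leibniz rule for the covariant derivative of an endomorphism field applied to a vector field. -/
theorem leviCivita_end_apply
    (A : ∀ y : M, TangentSpace 𝓘(ℝ, E) y →L[ℝ] TangentSpace 𝓘(ℝ, E) y)
    (W : ∀ y : M, TangentSpace 𝓘(ℝ, E) y) (y : M)
    (hA : DifferentiableAt ℝ (endCoord A y) (extChartAt 𝓘(ℝ, E) y y))
    (hW : DifferentiableAt ℝ (vectorFieldCoord W y) (extChartAt 𝓘(ℝ, E) y y))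
    (v : TangentSpace 𝓘(ℝ, E) y) :
    leviCivita (fun p => A p (W p)) y v = covDerivEnd A y v (W y) + A y (leviCivita W y v) := by
  have hy := mem_chart_source E y
  have hinj : Function.Injective (toCoord y y) :=
    Function.LeftInverse.injective (ofCoord_toCoord hy)
  apply hinj
  rw [leviCivita_apply, map_add, covDerivEnd_apply]
  have h1 : vectorFieldCoord (fun p => A p (W p)) y =ᶠ[nhds (extChartAt 𝓘(ℝ, E) y y)]
      fun z => endCoord A y z (vectorFieldCoord W y z) := by
    filter_upwards [target_mem_nhds (extChartAt_mem_target hy)] with z hz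
    exact vectorFieldCoord_end_apply A W hz
  rw [h1.fderiv_eq, (hA.hasFDerivAt.clm_apply hW.hasFDerivAt).fderiv]
  rw [← endCoord_extChartAt A hy (leviCivita W y v), leviCivita_apply]
  simp only [add_apply, ContinuousLinearMap.comp_apply, ContinuousLinearMap.flip_apply,
    vectorFieldCoord_extChartAt W hy, map_add]
  -- The term `-A Γ(v, W)` of the derivative of `A` cancels the Christoffel part of `A (∇_v W)`.
  rw [endCoord_apply A y _ ((christoffel _ _) _ _), extChartAt_symm_extChartAt hy]
  abel

variable [IsContMDiffRiemannianBundle 𝓘(ℝ, E) ∞ E (fun x : M => TangentSpace 𝓘(ℝ, E) x)]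

theorem contDiffAt_christoffel_metricCoord {x p : M} (hx : p ∈ (chartAt E x).source) :
    ContDiffAt ℝ ∞ (christoffel (metricCoord x)) (extChartAt 𝓘(ℝ, E) x p) :=
  contDiffAt_christoffel (contDiffAt_metricCoord hx)
    (metricCoord_isInvertible (extChartAt_mem_target hx))

/-- The covariant derivative of endomorphism fields is given by the same formula in all charts. -/
theorem toCoord_covDerivEnd
    (A : ∀ y : M, TangentSpace 𝓘(ℝ, E) y →L[ℝ] TangentSpace 𝓘(ℝ, E) y)
    (hA : ∀ x p : M, p ∈ (chartAt E x).source →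
      DifferentiableAt ℝ (endCoord A x) (extChartAt 𝓘(ℝ, E) x p))
    {x y : M} (hx : y ∈ (chartAt E x).source) (v w : TangentSpace 𝓘(ℝ, E) y) :
    toCoord x y (covDerivEnd A y v w) =
      fderiv ℝ (endCoord A x) (extChartAt 𝓘(ℝ, E) x y) (toCoord x y v) (toCoord x y w)
      + christoffel (metricCoord x) (extChartAt 𝓘(ℝ, E) x y) (toCoord x y v)
          (endCoord A x (extChartAt 𝓘(ℝ, E) x y) (toCoord x y w))
      - endCoord A x (extChartAt 𝓘(ℝ, E) x y) (christoffel (metricCoord x)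
          (extChartAt 𝓘(ℝ, E) x y) (toCoord x y v) (toCoord x y w)) := by
  have hy := mem_chart_source E y
  set w' := toCoord x y w with hw'
  -- `w` is extended with constant coordinates in the chart at `x`. The Leibniz rule expresses `(∇_v
  -- A) w` through `∇_v (A W)` and `∇_v W`, for which chart independence is known.
  let W : ∀ p : M, TangentSpace 𝓘(ℝ, E) p := fun p => ofCoord x p w'
  have hWy : W y = w := ofCoord_toCoord hx w
  have hWc : vectorFieldCoord W x =ᶠ[nhds (extChartAt 𝓘(ℝ, E) x y)] fun _ => w' := by
    filter_upwards [target_mem_nhds (extChartAt_mem_target hx)] with z hz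
    rw [vectorFieldCoord_eq W hz]
    exact toCoord_ofCoord (symm_mem_source hz) w'
  have hWd : DifferentiableAt ℝ (vectorFieldCoord W x) (extChartAt 𝓘(ℝ, E) x y) :=
    (differentiableAt_const w').congr_of_eventuallyEq hWc
  have hAWc : vectorFieldCoord (fun p => A p (W p)) x =ᶠ[nhds (extChartAt 𝓘(ℝ, E) x y)]
      fun z => endCoord A x z w' := by
    filter_upwards [target_mem_nhds (extChartAt_mem_target hx), hWc] with z hz h
    rw [vectorFieldCoord_end_apply A W hz, h]
  have hAW := (hA x y hx).hasFDerivAt.clm_apply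
    (hasFDerivAt_const w' (extChartAt 𝓘(ℝ, E) x y))
  have h := leviCivita_end_apply A W y (hA y y hy)
    (differentiableAt_vectorFieldCoord_coordChange W hx hy hWd) v
  have h2 := congrArg (toCoord x y) h
  rw [map_add, toCoord_leviCivita _ hx (hAW.differentiableAt.congr_of_eventuallyEq hAWc),
    ← endCoord_extChartAt A hx (leviCivita W y v), toCoord_leviCivita W hx hWd, hWy,
    hAWc.fderiv_eq, hAW.fderiv, hWc.fderiv_eq, ← endCoord_extChartAt A hx w, ← hw'] at h2
  rw [eq_sub_iff_add_eq]
  simpa using h2.symm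

end Endomorphisms

end ManifoldARC

/-! ### Covariant derivatives along curves. -/

namespace ManifoldARC

/-- The coordinate form of `∇g = 0`: in the sum of the two first-kind symbols the other derivatives
of `G` cancel. -/
theorem fderiv_metric_eq {E : Type*} [NormedAddCommGroup E] [NormedSpace ℝ E]
    {G : E → E →L[ℝ] E →L[ℝ] ℝ} {z : E} (hG : DifferentiableAt ℝ G z)
    (hinv : (G z).IsInvertible) (hsymm : ∀ y u v, G y u v = G y v u) (a u v : E) :
    fderiv ℝ G z a u v = G z (christoffel G z a u) v + G z u (christoffel G z a v) := by
  have hs : ∀ a u v, fderiv ℝ G z a u v = fderiv ℝ G z a v u := by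
    intro a u v
    rw [← fderiv_apply_apply hG, ← fderiv_apply_apply hG]
    simp_rw [hsymm _ u v]
  rw [hsymm z u, apply_christoffel hinv, apply_christoffel hinv, christoffelFirst_apply,
    christoffelFirst_apply, hs a v u]
  ring

section Curves

variable {E : Type*} [NormedAddCommGroup E] [NormedSpace ℝ E] [FiniteDimensional ℝ E]
  {M : Type*} [TopologicalSpace M] [ChartedSpace E M] [IsManifold 𝓘(ℝ, E) ∞ M]
  [RiemannianBundle (fun x : M => TangentSpace 𝓘(ℝ, E) x)]

/-- A vector field `U` along `c` in the coordinates of the chart at `x`. -/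
def alongCoord (c : ℝ → M) (U : ∀ t, TangentSpace 𝓘(ℝ, E) (c t)) (x : M) (t : ℝ) : E :=
  (trivializationAt E (TangentSpace 𝓘(ℝ, E)) x ⟨c t, U t⟩).2

theorem alongCoord_eq (c : ℝ → M) (U : ∀ t, TangentSpace 𝓘(ℝ, E) (c t)) {x : M} {t : ℝ}
    (h : c t ∈ (chartAt E x).source) : alongCoord c U x t = toCoord x (c t) (U t) :=
  trivializationAt_snd h _

theorem eventually_mem_chart_source {c : ℝ → M} {t : ℝ} (hc : ContinuousAt c t) :
    ∀ᶠ τ in nhds t, c τ ∈ (chartAt E (c t)).source :=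
  hc ((chartAt E (c t)).open_source.mem_nhds (mem_chart_source E (c t)))

theorem hasDerivAt_extChartAt_comp {c : ℝ → M} {t : ℝ}
    (hc : MDifferentiableAt 𝓘(ℝ, ℝ) 𝓘(ℝ, E) c t) :
    HasDerivAt (fun τ => extChartAt 𝓘(ℝ, E) (c t) (c τ))
      (toCoord (c t) (c t) (velocity c t)) t := by
  have h : HasFDerivWithinAt (fun τ => extChartAt 𝓘(ℝ, E) (c t) (c τ))
      (show ℝ →L[ℝ] E from mfderiv 𝓘(ℝ, ℝ) 𝓘(ℝ, E) c t) (Set.range 𝓘(ℝ, ℝ)) t :=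
    hc.hasMFDerivAt.2
  rw [ModelWithCorners.range_eq_univ, hasFDerivWithinAt_univ] at h
  refine HasDerivAt.congr_deriv h.hasDerivAt ?_
  exact (toCoord_self (c t) (velocity c t)).symm

theorem covDerivAlong_apply (c : ℝ → M) (U : ∀ t, TangentSpace 𝓘(ℝ, E) (c t)) (t : ℝ) :
    toCoord (c t) (c t) (covDerivAlong c U t) = deriv (alongCoord c U (c t)) t +
      christoffel (metricCoord (c t)) (extChartAt 𝓘(ℝ, E) (c t) (c t))
        (toCoord (c t) (c t) (velocity c t)) (toCoord (c t) (c t) (U t)) := by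
  refine (toCoord_self (c t) _).trans ?_
  rw [toCoord_self, toCoord_self]
  rfl

theorem alongCoord_vectorField (X : ∀ y : M, TangentSpace 𝓘(ℝ, E) y) {c : ℝ → M} {t : ℝ}
    (hc : ContinuousAt c t) :
    alongCoord c (fun τ => X (c τ)) (c t) =ᶠ[nhds t]
      fun τ => vectorFieldCoord X (c t) (extChartAt 𝓘(ℝ, E) (c t) (c τ)) := by
  filter_upwards [eventually_mem_chart_source (E := E) hc] with τ hτ
  rw [alongCoord_eq c _ hτ, vectorFieldCoord_extChartAt X hτ]

theorem alongCoord_end_apply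
    (A : ∀ y : M, TangentSpace 𝓘(ℝ, E) y →L[ℝ] TangentSpace 𝓘(ℝ, E) y) {c : ℝ → M}
    (U : ∀ t, TangentSpace 𝓘(ℝ, E) (c t)) {t : ℝ} (hc : ContinuousAt c t) :
    alongCoord c (fun τ => A (c τ) (U τ)) (c t) =ᶠ[nhds t]
      fun τ => endCoord A (c t) (extChartAt 𝓘(ℝ, E) (c t) (c τ)) (alongCoord c U (c t) τ) := by
  filter_upwards [eventually_mem_chart_source (E := E) hc] with τ hτ
  rw [alongCoord_eq c _ hτ, alongCoord_eq c _ hτ, endCoord_extChartAt A hτ]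

theorem differentiableAt_alongCoord_vectorField (X : ∀ y : M, TangentSpace 𝓘(ℝ, E) y) {c : ℝ → M}
    {t : ℝ} (hc : MDifferentiableAt 𝓘(ℝ, ℝ) 𝓘(ℝ, E) c t)
    (hX : DifferentiableAt ℝ (vectorFieldCoord X (c t)) (extChartAt 𝓘(ℝ, E) (c t) (c t))) :
    DifferentiableAt ℝ (alongCoord c (fun τ => X (c τ)) (c t)) t :=
  (DifferentiableAt.comp t hX (hasDerivAt_extChartAt_comp hc).differentiableAt
    :).congr_of_eventuallyEq (alongCoord_vectorField X hc.continuousAt)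

theorem covDerivAlong_vectorField (X : ∀ y : M, TangentSpace 𝓘(ℝ, E) y) {c : ℝ → M} {t : ℝ}
    (hc : MDifferentiableAt 𝓘(ℝ, ℝ) 𝓘(ℝ, E) c t)
    (hX : DifferentiableAt ℝ (vectorFieldCoord X (c t)) (extChartAt 𝓘(ℝ, E) (c t) (c t))) :
    covDerivAlong c (fun τ => X (c τ)) t = leviCivita X (c t) (velocity c t) := by
  have hy := mem_chart_source E (c t)
  apply Function.LeftInverse.injective (ofCoord_toCoord hy)
  have h : HasDerivAt (fun τ => vectorFieldCoord X (c t) (extChartAt 𝓘(ℝ, E) (c t) (c τ))) _ t :=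
    (hX.hasFDerivAt.comp_hasDerivAt t (hasDerivAt_extChartAt_comp hc) :)
  rw [covDerivAlong_apply, leviCivita_apply,
    (alongCoord_vectorField X hc.continuousAt).deriv_eq, h.deriv]

theorem hasDerivAt_alongCoord_end
    (A : ∀ y : M, TangentSpace 𝓘(ℝ, E) y →L[ℝ] TangentSpace 𝓘(ℝ, E) y) {c : ℝ → M}
    (U : ∀ t, TangentSpace 𝓘(ℝ, E) (c t)) {t : ℝ}
    (hc : MDifferentiableAt 𝓘(ℝ, ℝ) 𝓘(ℝ, E) c t)
    (hU : DifferentiableAt ℝ (alongCoord c U (c t)) t)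
    (hA : DifferentiableAt ℝ (endCoord A (c t)) (extChartAt 𝓘(ℝ, E) (c t) (c t))) :
    HasDerivAt (alongCoord c (fun τ => A (c τ) (U τ)) (c t))
      (fderiv ℝ (endCoord A (c t)) (extChartAt 𝓘(ℝ, E) (c t) (c t))
          (toCoord (c t) (c t) (velocity c t)) (alongCoord c U (c t) t) +
        endCoord A (c t) (extChartAt 𝓘(ℝ, E) (c t) (c t)) (deriv (alongCoord c U (c t)) t)) t := by
  have h : HasDerivAt (fun τ => endCoord A (c t) (extChartAt 𝓘(ℝ, E) (c t) (c τ))) _ t :=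
    (hA.hasFDerivAt.comp_hasDerivAt t (hasDerivAt_extChartAt_comp hc) :)
  exact (h.clm_apply hU.hasDerivAt).congr_of_eventuallyEq
    (alongCoord_end_apply A U hc.continuousAt)

theorem covDerivAlong_end_apply
    (A : ∀ y : M, TangentSpace 𝓘(ℝ, E) y →L[ℝ] TangentSpace 𝓘(ℝ, E) y) {c : ℝ → M}
    (U : ∀ t, TangentSpace 𝓘(ℝ, E) (c t)) {t : ℝ}
    (hc : MDifferentiableAt 𝓘(ℝ, ℝ) 𝓘(ℝ, E) c t)
    (hU : DifferentiableAt ℝ (alongCoord c U (c t)) t)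
    (hA : DifferentiableAt ℝ (endCoord A (c t)) (extChartAt 𝓘(ℝ, E) (c t) (c t))) :
    covDerivAlong c (fun τ => A (c τ) (U τ)) t =
      covDerivEnd A (c t) (velocity c t) (U t) + A (c t) (covDerivAlong c U t) := by
  have hy := mem_chart_source E (c t)
  apply Function.LeftInverse.injective (ofCoord_toCoord hy)
  rw [map_add, covDerivAlong_apply, covDerivEnd_apply, (hasDerivAt_alongCoord_end A U hc hU hA).deriv,
    ← endCoord_extChartAt A hy (covDerivAlong c U t), covDerivAlong_apply, alongCoord_eq c U hy,
    map_add]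
  rw [endCoord_apply A (c t) _ ((christoffel _ _) _ _), extChartAt_symm_extChartAt hy]
  abel

variable [IsContMDiffRiemannianBundle 𝓘(ℝ, E) ∞ E (fun x : M => TangentSpace 𝓘(ℝ, E) x)]

/-- Compatibility of the covariant derivative along curves with the metric. -/
theorem hasDerivAt_inner_along {c : ℝ → M} {U V : ∀ t, TangentSpace 𝓘(ℝ, E) (c t)} {t : ℝ}
    (hc : MDifferentiableAt 𝓘(ℝ, ℝ) 𝓘(ℝ, E) c t)
    (hU : DifferentiableAt ℝ (alongCoord c U (c t)) t)
    (hV : DifferentiableAt ℝ (alongCoord c V (c t)) t) :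
    HasDerivAt (fun τ => (inner ℝ (U τ) (V τ) : ℝ))
      (inner ℝ (covDerivAlong c U t) (V t) + inner ℝ (U t) (covDerivAlong c V t)) t := by
  have hy := mem_chart_source E (c t)
  have hG := (contDiffAt_metricCoord hy).differentiableAt (by simp)
  have h1 : (fun τ => (inner ℝ (U τ) (V τ) : ℝ)) =ᶠ[nhds t] fun τ => metricCoord (c t)
      (extChartAt 𝓘(ℝ, E) (c t) (c τ)) (alongCoord c U (c t) τ) (alongCoord c V (c t) τ) := by
    filter_upwards [eventually_mem_chart_source (E := E) hc.continuousAt] with τ hτ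
    rw [alongCoord_eq c U hτ, alongCoord_eq c V hτ, metricCoord_extChartAt hτ]
  have h2 : HasDerivAt (fun τ => metricCoord (c t) (extChartAt 𝓘(ℝ, E) (c t) (c τ))) _ t :=
    (hG.hasFDerivAt.comp_hasDerivAt t (hasDerivAt_extChartAt_comp hc) :)
  have h3 := ((h2.clm_apply hU.hasDerivAt).clm_apply hV.hasDerivAt).congr_of_eventuallyEq h1
  refine h3.congr_deriv ?_
  rw [← metricCoord_extChartAt hy (covDerivAlong c U t), ← metricCoord_extChartAt hy (U t),
    covDerivAlong_apply, covDerivAlong_apply, add_apply,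
    fderiv_metric_eq hG (metricCoord_isInvertible (extChartAt_mem_target hy)) (metricCoord_symm (c t)),
    alongCoord_eq c U hy, alongCoord_eq c V hy]
  simp only [map_add, add_apply]
  ring

/-- Derivative of the inner product of an ambient vector field with a vector field along `c`. -/
theorem hasDerivAt_inner_vectorField_along (X : ∀ y : M, TangentSpace 𝓘(ℝ, E) y) {c : ℝ → M}
    {U : ∀ t, TangentSpace 𝓘(ℝ, E) (c t)} {t : ℝ}
    (hc : MDifferentiableAt 𝓘(ℝ, ℝ) 𝓘(ℝ, E) c t)
    (hU : DifferentiableAt ℝ (alongCoord c U (c t)) t)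
    (hX : DifferentiableAt ℝ (vectorFieldCoord X (c t)) (extChartAt 𝓘(ℝ, E) (c t) (c t))) :
    HasDerivAt (fun τ => (inner ℝ (X (c τ)) (U τ) : ℝ))
      (inner ℝ (leviCivita X (c t) (velocity c t)) (U t) + inner ℝ (X (c t)) (covDerivAlong c U t))
      t := by
  have h := hasDerivAt_inner_along hc (differentiableAt_alongCoord_vectorField X hc hX) hU
  rwa [covDerivAlong_vectorField X hc hX] at h

/-- Leibniz rule for `A` combined with metric compatibility. Symmetry of `A` is not assumed, so the
two terms in `DU/dt` stay separate. -/
theorem hasDerivAt_inner_end_along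
    (A : ∀ y : M, TangentSpace 𝓘(ℝ, E) y →L[ℝ] TangentSpace 𝓘(ℝ, E) y) {c : ℝ → M}
    {U : ∀ t, TangentSpace 𝓘(ℝ, E) (c t)} {t : ℝ}
    (hc : MDifferentiableAt 𝓘(ℝ, ℝ) 𝓘(ℝ, E) c t)
    (hU : DifferentiableAt ℝ (alongCoord c U (c t)) t)
    (hA : DifferentiableAt ℝ (endCoord A (c t)) (extChartAt 𝓘(ℝ, E) (c t) (c t))) :
    HasDerivAt (fun τ => (inner ℝ (A (c τ) (U τ)) (U τ) : ℝ))
      (inner ℝ (covDerivEnd A (c t) (velocity c t) (U t)) (U t)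
        + inner ℝ (A (c t) (covDerivAlong c U t)) (U t)
        + inner ℝ (A (c t) (U t)) (covDerivAlong c U t)) t := by
  have h := hasDerivAt_inner_along hc (hasDerivAt_alongCoord_end A U hc hU hA).differentiableAt hU
  rw [covDerivAlong_end_apply A U hc hU hA] at h
  refine h.congr_deriv ?_
  rw [inner_add_left]

end Curves

/-! ### Regularity of the gradient and Hessian fields. -/

section Gradient

variable {E : Type*} [NormedAddCommGroup E] [NormedSpace ℝ E] [FiniteDimensional ℝ E]
  {M : Type*} [TopologicalSpace M] [ChartedSpace E M] [IsManifold 𝓘(ℝ, E) ∞ M]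
  [RiemannianBundle (fun x : M => TangentSpace 𝓘(ℝ, E) x)]

theorem inner_grad (f : M → ℝ) (y : M) (v : TangentSpace 𝓘(ℝ, E) y) :
    inner ℝ (grad f y) v = mfderiv 𝓘(ℝ, E) 𝓘(ℝ, ℝ) f y v := by
  rw [grad]
  exact InnerProductSpace.toDual_symm_apply

theorem metricCoord_grad {f : M → ℝ} (hf : MDifferentiable 𝓘(ℝ, E) 𝓘(ℝ, ℝ) f) {x : M} {z : E}
    (hz : z ∈ (extChartAt 𝓘(ℝ, E) x).target) :
    metricCoord x z (vectorFieldCoord (grad f) x z) =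
      fderiv ℝ (f ∘ (extChartAt 𝓘(ℝ, E) x).symm) z := by
  ext w
  have hs := symm_mem_source hz
  rw [vectorFieldCoord_eq _ hz, metricCoord_apply, ofCoord_toCoord hs, inner_grad]
  have h1 : MDifferentiableAt 𝓘(ℝ, E) 𝓘(ℝ, E) (extChartAt 𝓘(ℝ, E) x).symm z := by
    have := mdifferentiableWithinAt_extChartAt_symm (I := 𝓘(ℝ, E)) hz
    rwa [ModelWithCorners.range_eq_univ, mdifferentiableWithinAt_univ] at this
  have h2 := mfderiv_comp z (hf _) h1
  rw [mfderiv_eq_fderiv] at h2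
  have h3 : ofCoord x ((extChartAt 𝓘(ℝ, E) x).symm z) w =
      mfderiv 𝓘(ℝ, E) 𝓘(ℝ, E) (extChartAt 𝓘(ℝ, E) x).symm z w := by
    have h4 := TangentBundle.symmL_trivializationAt (I := 𝓘(ℝ, E)) hs
    rw [ModelWithCorners.range_eq_univ, mfderivWithin_univ,
      (extChartAt 𝓘(ℝ, E) x).right_inv hz] at h4
    exact congrArg (fun L => L w) h4
  rw [h3]
  exact (congrArg (fun L => L w) h2).symm

variable [IsContMDiffRiemannianBundle 𝓘(ℝ, E) ∞ E (fun x : M => TangentSpace 𝓘(ℝ, E) x)]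

/-- In coordinates `grad f = g⁻¹ df`, which costs one derivative of `f`. -/
theorem contDiffAt_vectorFieldCoord_grad {f : M → ℝ} (hf : ContMDiff 𝓘(ℝ, E) 𝓘(ℝ, ℝ) 3 f)
    {x p : M} (hx : p ∈ (chartAt E x).source) :
    ContDiffAt ℝ 2 (vectorFieldCoord (grad f) x) (extChartAt 𝓘(ℝ, E) x p) := by
  have hz := extChartAt_mem_target hx
  have h1 : ContDiffAt ℝ 3 (f ∘ (extChartAt 𝓘(ℝ, E) x).symm) (extChartAt 𝓘(ℝ, E) x p) := by
    have h : ContMDiffOn 𝓘(ℝ, E) 𝓘(ℝ, ℝ) 3 (f ∘ (extChartAt 𝓘(ℝ, E) x).symm)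
        (extChartAt 𝓘(ℝ, E) x).target := hf.comp_contMDiffOn (contMDiffOn_extChartAt_symm x)
    exact h.contDiffOn.contDiffAt (target_mem_nhds hz)
  have h2 : ContDiffAt ℝ 2 (fun y => (metricCoord x y).inverse) (extChartAt 𝓘(ℝ, E) x p) := by
    obtain ⟨e, he⟩ := metricCoord_isInvertible hz
    have h := contDiffAt_map_inverse (n := 2) e
    rw [he] at h
    exact h.comp _ ((contDiffAt_metricCoord hx).of_le ENat.LEInfty.out)
  refine (h2.clm_apply (h1.fderiv_right (m := 2) le_rfl)).congr_of_eventuallyEq ?_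
  filter_upwards [target_mem_nhds hz] with z hz
  rw [← metricCoord_grad (hf.mdifferentiable (by simp)) hz]
  obtain ⟨e, he⟩ := metricCoord_isInvertible hz
  rw [← he, ContinuousLinearMap.inverse_equiv]
  simp

/-- The coordinate expression is `DX + Γ(·, X)` with `X = grad f`, one derivative less than `X`.
That it holds at all nearby points in the same chart is where chart independence of the connection
enters. -/
theorem contDiffAt_endCoord_hess {f : M → ℝ} (hf : ContMDiff 𝓘(ℝ, E) 𝓘(ℝ, ℝ) 3 f)
    {x p : M} (hx : p ∈ (chartAt E x).source) :
    ContDiffAt ℝ 1 (endCoord (hess f) x) (extChartAt 𝓘(ℝ, E) x p) := by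
  have hz := extChartAt_mem_target hx
  have h := contDiffAt_vectorFieldCoord_grad hf hx
  have h1 : ContDiffAt ℝ 1 (fun z => fderiv ℝ (vectorFieldCoord (grad f) x) z +
      (christoffel (metricCoord x) z).flip (vectorFieldCoord (grad f) x z))
      (extChartAt 𝓘(ℝ, E) x p) := by
    refine (h.fderiv_right (m := 1) le_rfl).add (ContDiffAt.clm_apply ?_ (h.of_le (by norm_num)))
    exact (ContinuousLinearMap.flipₗᵢ ℝ E E E).contDiff.contDiffAt.comp _
      ((contDiffAt_christoffel_metricCoord hx).of_le ENat.LEInfty.out)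
  refine h1.congr_of_eventuallyEq ?_
  filter_upwards [target_mem_nhds hz] with z hz
  have hs := symm_mem_source hz
  have hd : DifferentiableAt ℝ (vectorFieldCoord (grad f) x)
      (extChartAt 𝓘(ℝ, E) x ((extChartAt 𝓘(ℝ, E) x).symm z)) :=
    (contDiffAt_vectorFieldCoord_grad hf hs).differentiableAt (by simp)
  ext w
  rw [endCoord_apply, hess, toCoord_leviCivita _ hs hd, toCoord_ofCoord hs,
    (extChartAt 𝓘(ℝ, E) x).right_inv hz, ← vectorFieldCoord_eq _ hz]
  simp

theorem differentiableAt_endCoord_hess {f : M → ℝ} (hf : ContMDiff 𝓘(ℝ, E) 𝓘(ℝ, ℝ) 3 f)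
    (x p : M) (hx : p ∈ (chartAt E x).source) :
    DifferentiableAt ℝ (endCoord (hess f) x) (extChartAt 𝓘(ℝ, E) x p) :=
  (contDiffAt_endCoord_hess hf hx).differentiableAt (by simp)

end Gradient

end ManifoldARC

namespace ManifoldARC

/-! ### Symmetric operators, gradients and Hessians on an inner product space. -/

section InnerProductSpace

variable {V : Type*} [NormedAddCommGroup V] [InnerProductSpace ℝ V] [CompleteSpace V]

/-- Polarization and the parallelogram law bound the bilinear form by `C / 2 * (‖u‖² + ‖v‖²)`;
normalizing `u` and `v` turns this into `C * ‖u‖ * ‖v‖`. -/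
theorem norm_le_of_forall_inner_self_le {D : V →L[ℝ] V} (hD : ∀ u v, inner ℝ (D u) v = inner ℝ (D v) u)
    {C : ℝ} (hC : 0 ≤ C) (h : ∀ u, |(inner ℝ (D u) u : ℝ)| ≤ C * ‖u‖ ^ 2) : ‖D‖ ≤ C := by
  have h1 : ∀ u v : V, |(inner ℝ (D u) v : ℝ)| ≤ C / 2 * (‖u‖ ^ 2 + ‖v‖ ^ 2) := by
    intro u v
    have e : (inner ℝ (D u) v : ℝ) =
        1 / 4 * (inner ℝ (D (u + v)) (u + v) - inner ℝ (D (u - v)) (u - v)) := by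
      simp only [map_add, map_sub, inner_add_left, inner_add_right, inner_sub_left, inner_sub_right]
      rw [hD v u]
      ring
    have hp := parallelogram_law_with_norm ℝ u v
    have h2 := abs_le.mp (h (u + v))
    have h3 := abs_le.mp (h (u - v))
    rw [e, abs_le]
    constructor <;> nlinarith
  have h4 : ∀ u v : V, |(inner ℝ (D u) v : ℝ)| ≤ C * ‖u‖ * ‖v‖ := by
    intro u v
    rcases eq_or_ne u 0 with rfl | hu
    · simp
    rcases eq_or_ne v 0 with rfl | hv
    · simp
    have hu' : 0 < ‖u‖ := norm_pos_iff.mpr hu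
    have hv' : 0 < ‖v‖ := norm_pos_iff.mpr hv
    have h5 := h1 (‖u‖⁻¹ • u) (‖v‖⁻¹ • v)
    rw [map_smul, real_inner_smul_left, real_inner_smul_right, norm_smul, norm_smul, abs_mul,
      abs_mul, norm_inv, norm_inv, norm_norm, norm_norm, abs_inv, abs_inv, abs_norm, abs_norm,
      inv_mul_cancel₀ hu'.ne', inv_mul_cancel₀ hv'.ne', ← mul_assoc, ← mul_inv,
      inv_mul_le_iff₀ (by positivity)] at h5
    linarith
  refine ContinuousLinearMap.opNorm_le_bound _ hC fun u => ?_
  rcases eq_or_ne (D u) 0 with h0 | h0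
  · rw [h0, norm_zero]
    positivity
  have h5 := h4 u (D u)
  rw [real_inner_self_eq_norm_sq, abs_of_nonneg (by positivity), sq] at h5
  exact le_of_mul_le_mul_right h5 (norm_pos_iff.mpr h0)

theorem inner_gradient (h : V → ℝ) (s u : V) : inner ℝ (∇ h s) u = fderiv ℝ h s u := by
  rw [gradient]
  exact InnerProductSpace.toDual_symm_apply

theorem gradient_eq_comp (h : V → ℝ) :
    ∇ h = (InnerProductSpace.toDual ℝ V).symm ∘ fderiv ℝ h := rfl

theorem hasFDerivAt_gradient {h : V → ℝ} {s : V} (hh : ContDiffAt ℝ 2 h s) :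
    HasFDerivAt (∇ h) (fderiv ℝ (∇ h) s) s := by
  rw [gradient_eq_comp]
  exact ((InnerProductSpace.toDual ℝ V).symm.differentiable.differentiableAt.comp s
    ((hh.fderiv_right (m := 1) le_rfl).differentiableAt (by simp))).hasFDerivAt

theorem inner_fderiv_gradient {h : V → ℝ} {s : V} (hh : ContDiffAt ℝ 2 h s) (u v : V) :
    inner ℝ (fderiv ℝ (∇ h) s u) v = fderiv ℝ (fderiv ℝ h) s u v := by
  have h1 : HasFDerivAt (∇ h) _ s :=
    (InnerProductSpace.toDual ℝ V).symm.toContinuousLinearEquiv.hasFDerivAt.comp s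
      ((hh.fderiv_right (m := 1) le_rfl).differentiableAt (by simp)).hasFDerivAt
  rw [h1.fderiv]
  exact InnerProductSpace.toDual_symm_apply

theorem inner_fderiv_gradient_comm {h : V → ℝ} {s : V} (hh : ContDiffAt ℝ 2 h s) (u v : V) :
    inner ℝ (fderiv ℝ (∇ h) s u) v = inner ℝ (fderiv ℝ (∇ h) s v) u := by
  rw [inner_fderiv_gradient hh, inner_fderiv_gradient hh]
  exact (hh.isSymmSndFDerivAt (by simp)).eq u v

theorem hasDerivAt_inner_gradient {h : V → ℝ} {s : V} (hh : ContDiffAt ℝ 2 h s) (u : V) :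
    HasDerivAt (fun τ : ℝ => (inner ℝ (∇ h (s + τ • u)) u : ℝ)) (inner ℝ (fderiv ℝ (∇ h) s u) u) 0 := by
  have h1 : HasDerivAt (fun τ : ℝ => s + τ • u) u 0 := by
    simpa using ((hasDerivAt_id (0 : ℝ)).smul_const u).const_add s
  have h2 : HasFDerivAt (∇ h) (fderiv ℝ (∇ h) s) (s + (0 : ℝ) • u) := by
    simpa using hasFDerivAt_gradient hh
  have h3 := (h2.comp_hasDerivAt 0 h1).inner ℝ (hasDerivAt_const (0 : ℝ) u)
  simpa using h3

end InnerProductSpace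

/-! ### Derivatives of pullbacks by a retraction. -/

section Retraction

variable {E : Type*} [NormedAddCommGroup E] [NormedSpace ℝ E] [FiniteDimensional ℝ E]
  {M : Type*} [TopologicalSpace M] [ChartedSpace E M] [IsManifold 𝓘(ℝ, E) ∞ M]
  [RiemannianBundle (fun x : M => TangentSpace 𝓘(ℝ, E) x)]
  {R : TangentBundle 𝓘(ℝ, E) M → M}

theorem contMDiff_retrAt (hR : IsRetraction R) (x : M) :
    ContMDiff 𝓘(ℝ, TangentSpace 𝓘(ℝ, E) x) 𝓘(ℝ, E) ∞ (retrAt R x) := by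
  have h : ContMDiff 𝓘(ℝ, TangentSpace 𝓘(ℝ, E) x) 𝓘(ℝ, E).tangent ∞
      (fun s : TangentSpace 𝓘(ℝ, E) x => (⟨x, s⟩ : TangentBundle 𝓘(ℝ, E) M)) := by
    intro s
    rw [contMDiffAt_totalSpace]
    refine ⟨contMDiffAt_const, ?_⟩
    have h1 : ContDiff ℝ ∞ (fun s : TangentSpace 𝓘(ℝ, E) x => toCoord (E := E) x x s) :=
      (toCoord (E := E) x x).contDiff
    exact h1.contMDiff.contMDiffAt.congr_of_eventuallyEq
      (Filter.Eventually.of_forall fun s => trivializationAt_snd (mem_chart_source E x) s)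
  exact hR.smooth.comp h

theorem mdifferentiableAt_retrAt (hR : IsRetraction R) (x : M) (s : TangentSpace 𝓘(ℝ, E) x) :
    MDifferentiableAt 𝓘(ℝ, TangentSpace 𝓘(ℝ, E) x) 𝓘(ℝ, E) (retrAt R x) s :=
  (contMDiff_retrAt hR x).mdifferentiable (by simp) s

theorem mdifferentiableAt_retrAt_comp (hR : IsRetraction R) (x : M)
    {ℓ : ℝ → TangentSpace 𝓘(ℝ, E) x} {t : ℝ} (hℓ : DifferentiableAt ℝ ℓ t) :
    MDifferentiableAt 𝓘(ℝ, ℝ) 𝓘(ℝ, E) (fun τ => retrAt R x (ℓ τ)) t :=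
  (mdifferentiableAt_retrAt hR x (ℓ t)).comp t hℓ.mdifferentiableAt

theorem velocity_retrAt_comp (hR : IsRetraction R) (x : M)
    {ℓ : ℝ → TangentSpace 𝓘(ℝ, E) x} {t : ℝ} {b : TangentSpace 𝓘(ℝ, E) x}
    (hℓ : HasDerivAt ℓ b t) :
    velocity (E := E) (fun τ => retrAt R x (ℓ τ)) t = diffRetr R x (ℓ t) b := by
  have h := mfderiv_comp t (mdifferentiableAt_retrAt hR x (ℓ t))
    hℓ.differentiableAt.mdifferentiableAt
  rw [mfderiv_eq_fderiv] at h
  have h2 := congrArg (fun L => L (1 : ℝ)) h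
  refine h2.trans ?_
  show diffRetr R x (ℓ t) (fderiv ℝ ℓ t 1) = _
  rw [hℓ.hasFDerivAt.fderiv]
  simp

/-- In the chart at `R_x(ℓ t)`, the field `T_{ℓ τ} u` is the derivative in the direction `u` of the
smooth chart expression of `R_x`, evaluated at `ℓ τ`. -/
theorem differentiableAt_alongCoord_diffRetr (hR : IsRetraction R) (x : M)
    {ℓ : ℝ → TangentSpace 𝓘(ℝ, E) x} {t : ℝ} (hℓ : DifferentiableAt ℝ ℓ t)
    (u : TangentSpace 𝓘(ℝ, E) x) :
    DifferentiableAt ℝ (alongCoord (fun τ => retrAt R x (ℓ τ))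
      (fun τ => diffRetr R x (ℓ τ) u) (retrAt R x (ℓ t))) t := by
  set y := retrAt R x (ℓ t) with hy
  have h1 : ContDiffAt ℝ ∞ (fun s => extChartAt 𝓘(ℝ, E) y (retrAt R x s)) (ℓ t) := by
    rw [← contMDiffAt_iff_contDiffAt]
    exact ContMDiffAt.comp (ℓ t) (contMDiffAt_extChartAt (x := y)) (contMDiff_retrAt hR x (ℓ t))
  have h2 : DifferentiableAt ℝ (fun τ => fderiv ℝ
      (fun s => extChartAt 𝓘(ℝ, E) y (retrAt R x s)) (ℓ τ) u) t := by
    have h3 := (h1.fderiv_right (m := ∞) le_rfl).differentiableAt (by simp)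
    exact ((DifferentiableAt.comp t h3 hℓ).clm_apply (differentiableAt_const u) :)
  refine h2.congr_of_eventuallyEq ?_
  have hc := (mdifferentiableAt_retrAt_comp hR x hℓ).continuousAt
  filter_upwards [eventually_mem_chart_source (E := E) hc] with τ hτ
  rw [alongCoord_eq _ _ hτ]
  have h4 : MDifferentiableAt 𝓘(ℝ, E) 𝓘(ℝ, E) (extChartAt 𝓘(ℝ, E) y) (retrAt R x (ℓ τ)) :=
    mdifferentiableAt_extChartAt hτ
  have h5 := mfderiv_comp (ℓ τ) h4 (mdifferentiableAt_retrAt hR x (ℓ τ))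
  rw [mfderiv_eq_fderiv] at h5
  have h6 := TangentBundle.continuousLinearMapAt_trivializationAt (I := 𝓘(ℝ, E)) hτ
  have h7 := congrArg (fun L => L u) h5
  refine Eq.trans ?_ h7.symm
  exact congrArg (fun L => L (diffRetr R x (ℓ τ) u)) h6

theorem contDiff_pullback {f : M → ℝ} {n : WithTop ℕ∞} (hn : n ≤ ∞)
    (hf : ContMDiff 𝓘(ℝ, E) 𝓘(ℝ, ℝ) n f)
    (hR : IsRetraction R) (x : M) : ContDiff ℝ n (pullback f R x) := by
  rw [← contMDiff_iff_contDiff]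
  exact hf.comp ((contMDiff_retrAt hR x).of_le hn)

theorem inner_gradient_pullback {f : M → ℝ} (hf : MDifferentiable 𝓘(ℝ, E) 𝓘(ℝ, ℝ) f)
    (hR : IsRetraction R) (x : M) (s u : TangentSpace 𝓘(ℝ, E) x) :
    (inner ℝ (∇ (pullback f R x) s) u : ℝ) = inner ℝ (grad f (retrAt R x s)) (diffRetr R x s u) := by
  rw [inner_gradient, inner_grad]
  have h := mfderiv_comp s (hf (retrAt R x s)) (mdifferentiableAt_retrAt hR x s)
  rw [mfderiv_eq_fderiv] at h
  exact congrArg (fun L => L u) h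

variable [IsContMDiffRiemannianBundle 𝓘(ℝ, E) ∞ E (fun x : M => TangentSpace 𝓘(ℝ, E) x)]

/-- The Hessian of the pullback in terms of the Riemannian gradient and Hessian. -/
theorem inner_tangentHess_pullback {f : M → ℝ} (hf : ContMDiff 𝓘(ℝ, E) 𝓘(ℝ, ℝ) 3 f)
    (hR : IsRetraction R) (x : M) (s u : TangentSpace 𝓘(ℝ, E) x) :
    (inner ℝ (tangentHess (pullback f R x) s u) u : ℝ) =
      inner ℝ (hess f (retrAt R x s) (diffRetr R x s u)) (diffRetr R x s u) +
      inner ℝ (grad f (retrAt R x (s + (0 : ℝ) • u)))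
        (acceleration (E := E) (fun τ => retrAt R x (s + τ • u)) 0) := by
  have hC := contDiff_pullback (n := 3) ENat.LEInfty.out hf hR x
  have h1 := hasDerivAt_inner_gradient (hC.contDiffAt.of_le (by norm_num) (x := s)) u
  have hℓ : ∀ τ : ℝ, HasDerivAt (fun τ : ℝ => s + τ • u) u τ := fun τ => by
    simpa using ((hasDerivAt_id τ).smul_const u).const_add s
  have hvel : velocity (E := E) (fun τ => retrAt R x (s + τ • u)) =
      fun τ => diffRetr R x (s + τ • u) u := funext fun τ => velocity_retrAt_comp hR x (hℓ τ)
  have h2 := hasDerivAt_inner_vectorField_along (grad f)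
    (mdifferentiableAt_retrAt_comp hR x (hℓ 0).differentiableAt)
    (differentiableAt_alongCoord_diffRetr hR x (hℓ 0).differentiableAt u)
    ((contDiffAt_vectorFieldCoord_grad hf (mem_chart_source E _)).differentiableAt (by simp))
  have h3 : (fun τ : ℝ => (inner ℝ (∇ (pullback f R x) (s + τ • u)) u : ℝ)) = fun τ =>
      inner ℝ (grad f (retrAt R x (s + τ • u))) (diffRetr R x (s + τ • u) u) :=
    funext fun τ => inner_gradient_pullback (hf.mdifferentiable (by simp)) hR x _ u
  rw [h3] at h1
  -- Two computations of the derivative at `0` of the same function `τ ↦ ⟨∇h(s + τ u), u⟩`, one in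
  -- the vector space and one on the manifold.
  rw [tangentHess, h1.unique h2, acceleration, hvel, hess]
  -- The acceleration is typed in the tangent space at `R_x(s + 0 u)`, so only the Hessian term is
  -- moved to base point `R_x(s)`.
  have h4 : s + (0 : ℝ) • u = s := by simp
  beta_reduce
  rw [h4]

end Retraction

end ManifoldARC

namespace ManifoldARC

/-! ### Taylor remainders from a Lipschitz bound at the origin. -/

section Taylor

variable {V : Type*} [NormedAddCommGroup V] [InnerProductSpace ℝ V] [CompleteSpace V]

/-- The remainder vanishes at `0` and its derivative has norm at most `L τ ‖s‖²`. It is stated for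
every `t`, not just `t = 1`, so that it can be integrated again for the scalar remainder. -/
theorem norm_gradient_sub_le {h : V → ℝ} (hh : ContDiff ℝ 2 h) {s : V} {L : ℝ}
    (hL : ∀ t ∈ Set.Icc (0 : ℝ) 1, ‖fderiv ℝ (∇ h) (t • s) - fderiv ℝ (∇ h) 0‖ ≤ L * t * ‖s‖)
    {t : ℝ} (ht : t ∈ Set.Icc (0 : ℝ) 1) :
    ‖∇ h (t • s) - ∇ h 0 - t • fderiv ℝ (∇ h) 0 s‖ ≤ L / 2 * t ^ 2 * ‖s‖ ^ 2 := by
  have hd : ∀ τ : ℝ, HasDerivAt (fun τ : ℝ => ∇ h (τ • s) - ∇ h 0 - τ • fderiv ℝ (∇ h) 0 s)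
      ((fderiv ℝ (∇ h) (τ • s) - fderiv ℝ (∇ h) 0) s) τ := by
    intro τ
    have h1 : HasDerivAt (fun τ : ℝ => τ • s) s τ := by
      simpa using (hasDerivAt_id τ).smul_const s
    have h2 : HasDerivAt (fun τ : ℝ => ∇ h (τ • s)) _ τ :=
      ((hasFDerivAt_gradient (hh.contDiffAt (x := τ • s))).comp_hasDerivAt τ h1 :)
    have h3 : HasDerivAt (fun τ : ℝ => τ • fderiv ℝ (∇ h) 0 s) (fderiv ℝ (∇ h) 0 s) τ := by
      simpa using (hasDerivAt_id τ).smul_const (fderiv ℝ (∇ h) 0 s)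
    exact (h2.sub_const _).sub h3
  have hB : ∀ τ : ℝ, HasDerivAt (fun τ : ℝ => L / 2 * τ ^ 2 * ‖s‖ ^ 2) (L * τ * ‖s‖ ^ 2) τ := by
    intro τ
    refine (((hasDerivAt_pow 2 τ).const_mul (L / 2)).mul_const (‖s‖ ^ 2)).congr_deriv ?_
    push_cast
    ring
  refine image_norm_le_of_norm_deriv_right_le_deriv_boundary
    (fun τ _ => (hd τ).continuousAt.continuousWithinAt) (fun τ _ => (hd τ).hasDerivWithinAt)
    (by simp) hB (fun τ hτ => ?_) ht
  refine (ContinuousLinearMap.le_opNorm _ s).trans ?_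
  have := mul_le_mul_of_nonneg_right (hL τ ⟨hτ.1, hτ.2.le⟩) (norm_nonneg s)
  linarith

theorem abs_sub_taylor_le {h : V → ℝ} (hh : ContDiff ℝ 2 h) {s : V} {L : ℝ}
    (hL : ∀ t ∈ Set.Icc (0 : ℝ) 1, ‖fderiv ℝ (∇ h) (t • s) - fderiv ℝ (∇ h) 0‖ ≤ L * t * ‖s‖) :
    |h s - (h 0 + inner ℝ s (∇ h 0) + 1 / 2 * inner ℝ s (fderiv ℝ (∇ h) 0 s))| ≤
      L / 6 * ‖s‖ ^ 3 := by
  have hd : ∀ τ : ℝ, HasDerivAt (fun τ : ℝ => h (τ • s) - (h 0 + τ * inner ℝ s (∇ h 0) +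
      τ ^ 2 * (1 / 2 * inner ℝ s (fderiv ℝ (∇ h) 0 s))))
      (inner ℝ s (∇ h (τ • s) - ∇ h 0 - τ • fderiv ℝ (∇ h) 0 s)) τ := by
    intro τ
    have h1 : HasDerivAt (fun τ : ℝ => τ • s) s τ := by
      simpa using (hasDerivAt_id τ).smul_const s
    have h2 : HasDerivAt (fun τ : ℝ => h (τ • s)) _ τ :=
      (((hh.differentiable (by simp)) (τ • s)).hasFDerivAt.comp_hasDerivAt τ h1 :)
    have h3 := (((hasDerivAt_id τ).mul_const (inner ℝ s (∇ h 0))).const_add (h 0)).add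
      ((hasDerivAt_pow 2 τ).mul_const (1 / 2 * inner ℝ s (fderiv ℝ (∇ h) 0 s)))
    refine (h2.sub h3).congr_deriv ?_
    rw [inner_sub_right, inner_sub_right, real_inner_smul_right,
      real_inner_comm (∇ h (τ • s)) s, inner_gradient]
    push_cast
    ring
  have hB : ∀ τ : ℝ, HasDerivAt (fun τ : ℝ => L / 6 * τ ^ 3 * ‖s‖ ^ 3) (L / 2 * τ ^ 2 * ‖s‖ ^ 3)
      τ := by
    intro τ
    refine (((hasDerivAt_pow 3 τ).const_mul (L / 6)).mul_const (‖s‖ ^ 3)).congr_deriv ?_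
    push_cast
    ring
  have key := image_norm_le_of_norm_deriv_right_le_deriv_boundary
    (fun τ _ => (hd τ).continuousAt.continuousWithinAt) (fun τ _ => (hd τ).hasDerivWithinAt)
    (by simp) hB (fun τ hτ => ?_) (Set.right_mem_Icc.mpr (zero_le_one (α := ℝ)))
  · simpa using key
  · refine (norm_inner_le_norm _ _).trans ?_
    have := mul_le_mul_of_nonneg_left (norm_gradient_sub_le hh hL ⟨hτ.1, hτ.2.le⟩) (norm_nonneg s)
    linarith

end Taylor

/-! ### The explicit Lipschitz constant. -/

section Bound

variable {E : Type*} [NormedAddCommGroup E] [NormedSpace ℝ E] [FiniteDimensional ℝ E]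
  {M : Type*} [TopologicalSpace M] [ChartedSpace E M] [IsManifold 𝓘(ℝ, E) ∞ M]
  [RiemannianBundle (fun x : M => TangentSpace 𝓘(ℝ, E) x)]
  {R : TangentBundle 𝓘(ℝ, E) M → M}

theorem SecondOrderNiceWith.mono {S S' : Set (TangentBundle 𝓘(ℝ, E) M)} {c₁ c₂ c₃ : ℝ}
    (h : SecondOrderNiceWith R S c₁ c₂ c₃) (hS : S' ⊆ S) : SecondOrderNiceWith R S' c₁ c₂ c₃ :=
  fun x s hs => h x s (hS hs)

variable [IsContMDiffRiemannianBundle 𝓘(ℝ, E) ∞ E (fun x : M => TangentSpace 𝓘(ℝ, E) x)]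

/-- Mean value inequality for `⟨Hess f [U], U⟩` along `t ↦ R_x(t s)`. The derivative of the Hessian
is taken along the velocity `T_{ts} s` and tested twice on `U`, whence `c₁³ J`; each of the two
terms in `DU/dt` contributes `c₁ c₂ H`. -/
theorem abs_inner_hess_sub_le {f : M → ℝ} (hf : ContMDiff 𝓘(ℝ, E) 𝓘(ℝ, ℝ) 3 f)
    (hR : IsRetraction R) {x : M} {s u : TangentSpace 𝓘(ℝ, E) x} {c₁ c₂ H J : ℝ}
    (h1 : ∀ t ∈ Set.Icc (0 : ℝ) 1, ‖diffRetr R x (t • s)‖ ≤ c₁)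
    (h2 : ∀ t ∈ Set.Icc (0 : ℝ) 1, ‖covDerivAlong (E := E) (fun τ => retrAt R x (τ • s))
      (fun τ => diffRetr R x (τ • s) u) t‖ ≤ c₂ * ‖s‖ * ‖u‖)
    (hH : ∀ t ∈ Set.Icc (0 : ℝ) 1, ‖hess (E := E) f (retrAt R x (t • s))‖ ≤ H)
    (hJ : ∀ t ∈ Set.Icc (0 : ℝ) 1, ∀ v, ‖covDerivEnd (hess (E := E) f) (retrAt R x (t • s)) v‖ ≤ J * ‖v‖)
    (hJ0 : 0 ≤ J) {t : ℝ} (ht : t ∈ Set.Icc (0 : ℝ) 1) :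
    |(inner ℝ (hess (E := E) f (retrAt R x (t • s)) (diffRetr R x (t • s) u)) (diffRetr R x (t • s) u) : ℝ)
      - inner ℝ (hess (E := E) f (retrAt R x ((0 : ℝ) • s)) (diffRetr R x ((0 : ℝ) • s) u))
          (diffRetr R x ((0 : ℝ) • s) u)| ≤
      (2 * c₁ * c₂ * H + c₁ ^ 3 * J) * ‖s‖ * ‖u‖ ^ 2 * t := by
  have hℓ : ∀ τ : ℝ, HasDerivAt (fun τ : ℝ => τ • s) s τ := fun τ => by
    simpa using (hasDerivAt_id τ).smul_const s
  have hd := fun τ : ℝ => hasDerivAt_inner_end_along (hess f)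
    (mdifferentiableAt_retrAt_comp hR x (hℓ τ).differentiableAt)
    (differentiableAt_alongCoord_diffRetr hR x (hℓ τ).differentiableAt u)
    (differentiableAt_endCoord_hess hf _ _ (mem_chart_source E _))
  have key := norm_image_sub_le_of_norm_deriv_le_segment' (a := 0) (b := 1)
    (fun τ _ => (hd τ).hasDerivWithinAt) (C := (2 * c₁ * c₂ * H + c₁ ^ 3 * J) * ‖s‖ * ‖u‖ ^ 2)
    (fun τ hτ => ?_) t ht
  · simpa using key
  have hτ' : τ ∈ Set.Icc (0 : ℝ) 1 := ⟨hτ.1, hτ.2.le⟩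
  have hc1 : 0 ≤ c₁ := (norm_nonneg _).trans (h1 τ hτ')
  have hH0 : 0 ≤ H := (norm_nonneg _).trans (hH τ hτ')
  have hU : ‖diffRetr R x (τ • s) u‖ ≤ c₁ * ‖u‖ := ContinuousLinearMap.le_of_opNorm_le _ (h1 τ hτ') u
  have hv : ‖diffRetr R x (τ • s) s‖ ≤ c₁ * ‖s‖ := ContinuousLinearMap.le_of_opNorm_le _ (h1 τ hτ') s
  have hA := h2 τ hτ'
  -- No sign is assumed for `c₂`; nonnegativity of the product is read off the bound.
  have hA0 : 0 ≤ c₂ * ‖s‖ * ‖u‖ := (norm_nonneg _).trans hA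
  have e1 : ∀ w, ‖covDerivEnd (hess (E := E) f) (retrAt R x (τ • s)) (diffRetr R x (τ • s) s) w‖ ≤
      (J * (c₁ * ‖s‖)) * ‖w‖ := fun w =>
    ContinuousLinearMap.le_of_opNorm_le _ ((hJ τ hτ' _).trans (by gcongr)) w
  have e2 : ∀ w, ‖hess (E := E) f (retrAt R x (τ • s)) w‖ ≤ H * ‖w‖ := fun w =>
    ContinuousLinearMap.le_of_opNorm_le _ (hH τ hτ') w
  rw [velocity_retrAt_comp hR x (hℓ τ)]
  refine (norm_add₃_le).trans ?_
  have b1 := (norm_inner_le_norm (𝕜 := ℝ) (covDerivEnd (hess (E := E) f) (retrAt R x (τ • s))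
    (diffRetr R x (τ • s) s) (diffRetr R x (τ • s) u)) (diffRetr R x (τ • s) u)).trans
    (mul_le_mul ((e1 _).trans (mul_le_mul_of_nonneg_left hU (by positivity))) hU (norm_nonneg _)
      (by positivity))
  have b2 := (norm_inner_le_norm (𝕜 := ℝ) (hess (E := E) f (retrAt R x (τ • s))
    (covDerivAlong (E := E) (fun τ => retrAt R x (τ • s)) (fun τ => diffRetr R x (τ • s) u) τ))
    (diffRetr R x (τ • s) u)).trans
    (mul_le_mul ((e2 _).trans (mul_le_mul_of_nonneg_left hA hH0)) hU (norm_nonneg _)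
      (by positivity))
  have b3 := (norm_inner_le_norm (𝕜 := ℝ) (hess (E := E) f (retrAt R x (τ • s)) (diffRetr R x (τ • s) u))
    (covDerivAlong (E := E) (fun τ => retrAt R x (τ • s)) (fun τ => diffRetr R x (τ • s) u) τ)).trans
    (mul_le_mul ((e2 _).trans (mul_le_mul_of_nonneg_left hU hH0)) hA (norm_nonneg _)
      (by positivity))
  refine (add_le_add (add_le_add b1 b2) b3).trans (le_of_eq ?_)
  ring

/-- Lipschitz bound at the origin for the Hessian of the pullback. -/
theorem norm_tangentHess_sub_le {f : M → ℝ} (hf : ContMDiff 𝓘(ℝ, E) 𝓘(ℝ, ℝ) 3 f)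
    (hR : IsRetraction R) {x : M} {s : TangentSpace 𝓘(ℝ, E) x} {c₁ c₂ c₃ G H J : ℝ}
    (hnice : SecondOrderNiceWith R {p | ∃ t ∈ Set.Icc (0 : ℝ) 1, p = ⟨x, t • s⟩} c₁ c₂ c₃)
    (hG : ∀ t ∈ Set.Icc (0 : ℝ) 1, ‖grad (E := E) f (retrAt R x (t • s))‖ ≤ G)
    (hH : ∀ t ∈ Set.Icc (0 : ℝ) 1, ‖hess (E := E) f (retrAt R x (t • s))‖ ≤ H)
    (hJ : ∀ t ∈ Set.Icc (0 : ℝ) 1, ∀ v, ‖covDerivEnd (hess (E := E) f) (retrAt R x (t • s)) v‖ ≤ J * ‖v‖)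
    (hJ0 : 0 ≤ J) {t : ℝ} (ht : t ∈ Set.Icc (0 : ℝ) 1) :
    ‖tangentHess (pullback f R x) (t • s) - tangentHess (pullback f R x) 0‖ ≤
      (c₃ * G + 2 * c₁ * c₂ * H + c₁ ^ 3 * J) * t * ‖s‖ := by
  have h0 : (0 : ℝ) ∈ Set.Icc (0 : ℝ) 1 := ⟨le_rfl, zero_le_one⟩
  have hs1 : (⟨x, s⟩ : TangentBundle 𝓘(ℝ, E) M) ∈
      {p : TangentBundle 𝓘(ℝ, E) M | ∃ t ∈ Set.Icc (0 : ℝ) 1, p = ⟨x, t • s⟩} :=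
    ⟨1, ⟨zero_le_one, le_rfl⟩, by rw [one_smul]⟩
  have hC := contDiff_pullback (n := 3) ENat.LEInfty.out hf hR x
  have hC2 : ContDiff ℝ 2 (pullback f R x) := hC.of_le (by norm_num)
  have hquad : ∀ u, |(inner ℝ ((tangentHess (pullback f R x) (t • s) -
      tangentHess (pullback f R x) 0) u) u : ℝ)| ≤
      (c₃ * G + 2 * c₁ * c₂ * H + c₁ ^ 3 * J) * t * ‖s‖ * ‖u‖ ^ 2 := by
    intro u
    have hq := abs_inner_hess_sub_le hf hR (fun τ hτ => (hnice x s hs1 u).1 τ hτ)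
      (fun τ hτ => (hnice x s hs1 u).2.1 τ hτ) hH hJ hJ0 ht
    have ha : ∀ τ ∈ Set.Icc (0 : ℝ) 1,
        |(inner ℝ (grad f (retrAt R x (τ • s + (0 : ℝ) • u)))
          (acceleration (E := E) (fun r => retrAt R x (τ • s + r • u)) 0) : ℝ)| ≤
        c₃ * G * τ * ‖s‖ * ‖u‖ ^ 2 := by
      intro τ hτ
      -- The acceleration bound is used at the partial step `(x, τ s)`, whose norm supplies the
      -- factor `τ`. At `τ = 0` the acceleration term is therefore zero, and the difference costs
      -- `c₃ G t` only.
      have h3 := (hnice x (τ • s) ⟨τ, hτ, rfl⟩ u).2.2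
      have h4 : ‖grad (E := E) f (retrAt R x (τ • s + (0 : ℝ) • u))‖ ≤ G := by
        have e : τ • s + (0 : ℝ) • u = τ • s := by simp
        rw [e]
        exact hG τ hτ
      refine (abs_real_inner_le_norm _ _).trans
        ((mul_le_mul h4 h3 (norm_nonneg _) ((norm_nonneg _).trans h4)).trans (le_of_eq ?_))
      rw [norm_smul, Real.norm_of_nonneg hτ.1]
      ring
    have e0 := inner_tangentHess_pullback hf hR x ((0 : ℝ) • s) u
    rw [sub_apply, inner_sub_left, inner_tangentHess_pullback hf hR x (t • s) u,
      ← zero_smul ℝ s, e0]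
    have h5 := abs_le.mp hq
    have h6 := abs_le.mp (ha t ht)
    have h7 := abs_le.mp (ha 0 h0)
    rw [abs_le]
    constructor <;> linarith [h5.1, h5.2, h6.1, h6.2, h7.1, h7.2]
  -- The constants may have any sign. For `s ≠ 0`, nonnegativity of the bound follows from the
  -- quadratic estimate at `u = s`; for `s = 0` both sides vanish.
  rcases eq_or_ne s 0 with rfl | hs
  · simp
  have hs' : 0 < ‖s‖ := norm_pos_iff.mpr hs
  have hpos : 0 ≤ (c₃ * G + 2 * c₁ * c₂ * H + c₁ ^ 3 * J) * t * ‖s‖ :=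
    nonneg_of_mul_nonneg_left ((abs_nonneg _).trans (hquad s)) (by positivity)
  refine norm_le_of_forall_inner_self_le (fun u v => ?_) hpos hquad
  simp only [sub_apply, inner_sub_left, tangentHess]
  rw [inner_fderiv_gradient_comm hC2.contDiffAt, inner_fderiv_gradient_comm hC2.contDiffAt u v]

end Bound

end ManifoldARC

/-! ### Existence of the maxima over a compact set. -/

namespace ManifoldARC

theorem exists_norm_le_one_norm_eq {V W : Type*} [NormedAddCommGroup V] [NormedSpace ℝ V]
    [FiniteDimensional ℝ V] [NormedAddCommGroup W] [NormedSpace ℝ W] (L : V →L[ℝ] W) :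
    ∃ v, ‖v‖ ≤ 1 ∧ ‖L v‖ = ‖L‖ := by
  have : ProperSpace V := FiniteDimensional.proper ℝ V
  obtain ⟨v, hv, hmax⟩ := (isCompact_closedBall (0 : V) 1).exists_isMaxOn
    ⟨0, by simp⟩ (L.continuous.norm.continuousOn)
  have hv1 : ‖v‖ ≤ 1 := by simpa using hv
  refine ⟨v, hv1, le_antisymm ?_ ?_⟩
  · exact (L.le_opNorm v).trans (mul_le_of_le_one_right (norm_nonneg _) hv1)
  · refine L.opNorm_le_bound (norm_nonneg _) fun u => ?_
    rcases eq_or_ne u 0 with rfl | hu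
    · simp
    have hu' : 0 < ‖u‖ := norm_pos_iff.mpr hu
    have h : ‖L (‖u‖⁻¹ • u)‖ ≤ ‖L v‖ := hmax (by
      simp [norm_smul, inv_mul_cancel₀ hu'.ne'])
    rw [map_smul, norm_smul, norm_inv, norm_norm, inv_mul_le_iff₀ hu'] at h
    linarith

/-- Meant for norms `n y` taken in varying tangent spaces: `w` is the same object transported to a
fixed space, and `k` counts the transports, each costing a factor `r` arbitrarily close to `1`. -/
theorem upperSemicontinuousAt_of_le {X W : Type*} [TopologicalSpace X] [NormedAddCommGroup W]
    {n : X → ℝ} {w : X → W} {x : X} (k : ℕ) (hw : ContinuousAt w x) (hx : ‖w x‖ ≤ n x)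
    (h : ∀ r : ℝ, 1 < r → ∀ᶠ y in nhds x, n y ≤ r ^ k * ‖w y‖) : UpperSemicontinuousAt n x := by
  intro c hc
  have h1 : Filter.Tendsto (fun r : ℝ => r ^ k * ((‖w x‖ + c) / 2)) (nhdsWithin 1 (Set.Ioi 1))
      (nhds (1 ^ k * ((‖w x‖ + c) / 2))) :=
    ((((continuous_pow k).mul continuous_const).tendsto (1 : ℝ))).mono_left nhdsWithin_le_nhds
  rw [one_pow, one_mul] at h1
  obtain ⟨r, hr1, hr2⟩ := ((h1.eventually (gt_mem_nhds (show (‖w x‖ + c) / 2 < c by linarith))).and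
    self_mem_nhdsWithin).exists
  filter_upwards [h r hr2, hw.norm.eventually (gt_mem_nhds (show ‖w x‖ < (‖w x‖ + c) / 2 by
    linarith))] with y hy1 hy2
  have hr0 : (0 : ℝ) < r ^ k := pow_pos (zero_lt_one.trans hr2) k
  exact (hy1.trans (mul_le_mul_of_nonneg_left hy2.le hr0.le)).trans_lt hr1

section Maxima

variable {E : Type*} [NormedAddCommGroup E] [NormedSpace ℝ E] [FiniteDimensional ℝ E]
  {M : Type*} [TopologicalSpace M] [ChartedSpace E M] [IsManifold 𝓘(ℝ, E) ∞ M]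
  [RiemannianBundle (fun x : M => TangentSpace 𝓘(ℝ, E) x)]

/-- The covariant derivative of a field of endomorphisms as a bilinear map. -/
def covDerivEndL (A : ∀ y : M, TangentSpace 𝓘(ℝ, E) y →L[ℝ] TangentSpace 𝓘(ℝ, E) y) (y : M) :
    TangentSpace 𝓘(ℝ, E) y →L[ℝ] TangentSpace 𝓘(ℝ, E) y →L[ℝ] TangentSpace 𝓘(ℝ, E) y :=
  LinearMap.toContinuousLinearMap
    { toFun := fun v => covDerivEnd A y v
      map_add' := fun v w => by
        ext u
        apply Function.LeftInverse.injective (ofCoord_toCoord (mem_chart_source E y))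
        rw [add_apply, map_add, covDerivEnd_apply, covDerivEnd_apply, covDerivEnd_apply]
        simp only [map_add, add_apply]
        abel
      map_smul' := fun r v => by
        ext u
        apply Function.LeftInverse.injective (ofCoord_toCoord (mem_chart_source E y))
        rw [smul_apply, map_smul, covDerivEnd_apply, covDerivEnd_apply]
        simp only [map_smul, smul_apply, RingHom.id_apply, smul_add, smul_sub] }

theorem covDerivEndL_apply (A : ∀ y : M, TangentSpace 𝓘(ℝ, E) y →L[ℝ] TangentSpace 𝓘(ℝ, E) y)
    (y : M) (v : TangentSpace 𝓘(ℝ, E) y) : covDerivEndL A y v = covDerivEnd A y v := rfl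

variable [IsContMDiffRiemannianBundle 𝓘(ℝ, E) ∞ E (fun x : M => TangentSpace 𝓘(ℝ, E) x)]

theorem eventually_norm_ofCoord_toCoord_lt (x : M) {r : ℝ} (hr : 1 < r) :
    ∀ᶠ y in nhds x, ‖(ofCoord x x ∘L toCoord x y : TangentSpace 𝓘(ℝ, E) y →L[ℝ] _)‖ < r ∧
      ‖(ofCoord x y ∘L toCoord x x : TangentSpace 𝓘(ℝ, E) x →L[ℝ] TangentSpace 𝓘(ℝ, E) y)‖ < r := by
  have : IsContinuousRiemannianBundle E (fun x : M => TangentSpace 𝓘(ℝ, E) x) :=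
    isContinuousRiemannianBundle_tangentSpace
  exact (eventually_norm_symmL_trivializationAt_self_comp_lt E
    (fun x : M => TangentSpace 𝓘(ℝ, E) x) x hr).and
    (eventually_norm_symmL_trivializationAt_comp_self_lt E
      (fun x : M => TangentSpace 𝓘(ℝ, E) x) x hr)

/-- By continuity of the metric, the chart identification of the fibres at `x` and at nearby points
is almost isometric in both directions. -/
theorem eventually_frame (x : M) {r : ℝ} (hr : 1 < r) :
    ∀ᶠ y in nhds x, y ∈ (chartAt E x).source ∧
      (∀ u : TangentSpace 𝓘(ℝ, E) y, ‖ofCoord x x (toCoord x y u)‖ ≤ r * ‖u‖) ∧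
      ∀ w : TangentSpace 𝓘(ℝ, E) x, ‖ofCoord x y (toCoord x x w)‖ ≤ r * ‖w‖ := by
  filter_upwards [eventually_norm_ofCoord_toCoord_lt (E := E) x hr,
    (chartAt E x).open_source.mem_nhds (mem_chart_source E x)] with y hy hs
  exact ⟨hs, fun u => ContinuousLinearMap.le_of_opNorm_le _ hy.1.le u,
    fun w => ContinuousLinearMap.le_of_opNorm_le _ hy.2.le w⟩

theorem upperSemicontinuousAt_norm_grad {f : M → ℝ} (hf : ContMDiff 𝓘(ℝ, E) 𝓘(ℝ, ℝ) 3 f)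
    (x : M) : UpperSemicontinuousAt (fun y => ‖grad (E := E) f y‖) x := by
  have hx := mem_chart_source E x
  refine upperSemicontinuousAt_of_le 1
    (w := fun y => ofCoord (E := E) x x (vectorFieldCoord (grad f) x (extChartAt 𝓘(ℝ, E) x y)))
    ?_ ?_ fun r hr => ?_
  · refine (ofCoord (E := E) x x).continuous.continuousAt.comp ?_
    exact ContinuousAt.comp (f := extChartAt 𝓘(ℝ, E) x)
      (contDiffAt_vectorFieldCoord_grad hf hx).continuousAt (continuousAt_extChartAt x)
  · rw [vectorFieldCoord_extChartAt _ hx, ofCoord_toCoord hx]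
  · filter_upwards [eventually_frame (E := E) x hr] with y ⟨hs, _, hy⟩
    have h := hy (ofCoord x x (toCoord x y (grad f y)))
    rw [toCoord_ofCoord hx, ofCoord_toCoord hs] at h
    rwa [vectorFieldCoord_extChartAt _ hs, pow_one]

/-- One transport for the argument and one for the value, hence exponent `2`. -/
theorem upperSemicontinuousAt_norm_hess {f : M → ℝ} (hf : ContMDiff 𝓘(ℝ, E) 𝓘(ℝ, ℝ) 3 f)
    (x : M) : UpperSemicontinuousAt (fun y => ‖hess (E := E) f y‖) x := by
  have hx := mem_chart_source E x
  refine upperSemicontinuousAt_of_le 2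
    (w := fun y => (ofCoord (E := E) x x ∘L
      endCoord (hess f) x (extChartAt 𝓘(ℝ, E) x y)) ∘L toCoord x x) ?_ ?_ fun r hr => ?_
  · refine (continuousAt_const.clm_comp ?_).clm_comp continuousAt_const
    exact ContinuousAt.comp (f := extChartAt 𝓘(ℝ, E) x)
      (contDiffAt_endCoord_hess hf hx).continuousAt (continuousAt_extChartAt x)
  · refine le_of_eq (congrArg norm ?_)
    ext u
    simp only [ContinuousLinearMap.comp_apply]
    rw [endCoord_extChartAt _ hx, ofCoord_toCoord hx]
  · filter_upwards [eventually_frame (E := E) x hr] with y ⟨hs, hP, hQ⟩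
    have hr0 : 0 < r := zero_lt_one.trans hr
    refine ContinuousLinearMap.opNorm_le_bound _ (by positivity) fun u => ?_
    set w := (ofCoord (E := E) x x ∘L
      endCoord (hess f) x (extChartAt 𝓘(ℝ, E) x y)) ∘L toCoord x x with hw
    have h := hQ (w (ofCoord x x (toCoord x y u)))
    have e : ofCoord x y (toCoord x x (w (ofCoord x x (toCoord x y u)))) = hess f y u := by
      simp only [hw, ContinuousLinearMap.comp_apply]
      rw [toCoord_ofCoord hx, toCoord_ofCoord hx, endCoord_extChartAt _ hs, ofCoord_toCoord hs]
    rw [e] at h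
    calc ‖hess f y u‖ ≤ r * ‖w (ofCoord x x (toCoord x y u))‖ := h
      _ ≤ r * (‖w‖ * (r * ‖u‖)) := by
        gcongr
        exact (w.le_opNorm _).trans (by gcongr; exact hP u)
      _ = r ^ 2 * ‖w‖ * ‖u‖ := by ring

theorem upperSemicontinuousAt_norm_covDerivEndL_hess {f : M → ℝ}
    (hf : ContMDiff 𝓘(ℝ, E) 𝓘(ℝ, ℝ) 3 f) (x : M) :
    UpperSemicontinuousAt (fun y => ‖covDerivEndL (hess (E := E) f) y‖) x := by
  have hx := mem_chart_source E x
  -- The chart formula for `∇ Hess f`, as a bilinear map assembled from compositions so that its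
  -- continuity in `z` can be read off. Two arguments and one value give exponent `3` below.
  let D : E → E →L[ℝ] E →L[ℝ] E := fun z => fderiv ℝ (endCoord (hess f) x) z
    + ((ContinuousLinearMap.compL ℝ E E E).flip (endCoord (hess f) x z)) ∘L
      christoffel (metricCoord x) z
    - (ContinuousLinearMap.compL ℝ E E E (endCoord (hess f) x z)) ∘L christoffel (metricCoord x) z
  have hDc : ContinuousAt D (extChartAt 𝓘(ℝ, E) x x) := by
    have hA := (contDiffAt_endCoord_hess hf hx)
    have hΓ := (contDiffAt_christoffel_metricCoord (E := E) hx).continuousAt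
    have hdA : ContinuousAt (fderiv ℝ (endCoord (hess f) x)) (extChartAt 𝓘(ℝ, E) x x) :=
      (hA.fderiv_right (m := 0) (by simp)).continuousAt
    refine (hdA.add (ContinuousAt.clm_comp ?_ hΓ)).sub (ContinuousAt.clm_comp ?_ hΓ)
    · exact ((ContinuousLinearMap.compL ℝ E E E).flip.continuous.continuousAt).comp hA.continuousAt
    · exact ((ContinuousLinearMap.compL ℝ E E E).continuous.continuousAt).comp hA.continuousAt
  have hD : ∀ y ∈ (chartAt E x).source, ∀ v w : TangentSpace 𝓘(ℝ, E) y,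
      D (extChartAt 𝓘(ℝ, E) x y) (toCoord x y v) (toCoord x y w) =
        toCoord x y (covDerivEnd (hess f) y v w) := by
    intro y hy v w
    rw [toCoord_covDerivEnd (hess f) (differentiableAt_endCoord_hess hf) hy]
    rfl
  let conj : (E →L[ℝ] E) →L[ℝ] TangentSpace 𝓘(ℝ, E) x →L[ℝ] TangentSpace 𝓘(ℝ, E) x :=
    (ContinuousLinearMap.compL ℝ (TangentSpace 𝓘(ℝ, E) x) E (TangentSpace 𝓘(ℝ, E) x)
      (ofCoord x x)) ∘L
    (ContinuousLinearMap.compL ℝ (TangentSpace 𝓘(ℝ, E) x) E E).flip (toCoord x x)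
  have hconj : ∀ S u, conj S u = ofCoord x x (S (toCoord x x u)) := fun S u => rfl
  refine upperSemicontinuousAt_of_le 3
    (w := fun y => (conj ∘L D (extChartAt 𝓘(ℝ, E) x y)) ∘L toCoord x x) ?_ ?_ fun r hr => ?_
  · refine (continuousAt_const.clm_comp ?_).clm_comp continuousAt_const
    exact ContinuousAt.comp (f := extChartAt 𝓘(ℝ, E) x) hDc (continuousAt_extChartAt x)
  · refine le_of_eq (congrArg norm ?_)
    ext v u
    simp only [ContinuousLinearMap.comp_apply]
    rw [hconj, hD x hx, ofCoord_toCoord hx, covDerivEndL_apply]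
  · filter_upwards [eventually_frame (E := E) x hr] with y ⟨hs, hP, hQ⟩
    have hr0 : 0 < r := zero_lt_one.trans hr
    set w := (conj ∘L D (extChartAt 𝓘(ℝ, E) x y)) ∘L toCoord x x with hw
    refine ContinuousLinearMap.opNorm_le_bound₂ _ (by positivity) fun v u => ?_
    have h := hQ (w (ofCoord x x (toCoord x y v)) (ofCoord x x (toCoord x y u)))
    have e : ofCoord x y (toCoord x x (w (ofCoord x x (toCoord x y v))
        (ofCoord x x (toCoord x y u)))) = covDerivEnd (hess f) y v u := by
      simp only [hw, ContinuousLinearMap.comp_apply]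
      rw [hconj, toCoord_ofCoord hx, toCoord_ofCoord hx, toCoord_ofCoord hx, hD y hs,
        ofCoord_toCoord hs]
    rw [e] at h
    rw [covDerivEndL_apply]
    calc ‖covDerivEnd (hess f) y v u‖
        ≤ r * ‖w (ofCoord x x (toCoord x y v)) (ofCoord x x (toCoord x y u))‖ := h
      _ ≤ r * (‖w‖ * (r * ‖v‖) * (r * ‖u‖)) := by
        gcongr
        exact (w.le_opNorm₂ _ _).trans (by gcongr; exacts [hP v, hP u])
      _ = r ^ 3 * ‖w‖ * ‖v‖ * ‖u‖ := by ring

end Maxima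

theorem exists_forall_le_of_upperSemicontinuousAt {X : Type*} [TopologicalSpace X] {n : X → ℝ}
    (hn : ∀ x, UpperSemicontinuousAt n x) {N : Set X} (hN : IsCompact N) (hne : N.Nonempty) :
    ∃ y ∈ N, ∀ z ∈ N, n z ≤ n y := by
  obtain ⟨y, hy, hmax⟩ := UpperSemicontinuousOn.exists_isMaxOn hne hN
    (fun x _ => (hn x).upperSemicontinuousWithinAt N)
  exact ⟨y, hy, fun z hz => hmax hz⟩

end ManifoldARC

/-! ### Uniform bounds over tangent vectors of bounded norm. -/

namespace ManifoldARC

/-- Bounds fibre derivatives of a pullback, in the norm of that fibre, by those of one joint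
coordinate function. The slice is a translation after the linear map `(0, L)`, of norm at most
`‖L‖`. -/
theorem norm_iteratedFDeriv_slice_le {E F V W : Type*} [NormedAddCommGroup E] [NormedSpace ℝ E]
    [NormedAddCommGroup F] [NormedSpace ℝ F] [NormedAddCommGroup V] [NormedSpace ℝ V]
    [NormedAddCommGroup W] [NormedSpace ℝ W] {Φ : E × F → W} {U : Set E} (hU : IsOpen U) {n : ℕ}
    (hΦ : ContDiffOn ℝ n Φ (U ×ˢ Set.univ)) (L : V →L[ℝ] F) {z : E} (hz : z ∈ U) (s : V) {i : ℕ}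
    (hi : i ≤ n) :
    ‖iteratedFDeriv ℝ i (fun s => Φ (z, L s)) s‖ ≤ ‖iteratedFDeriv ℝ i Φ (z, L s)‖ * ‖L‖ ^ i := by
  set g : V →L[ℝ] E × F := (ContinuousLinearMap.inr ℝ E F) ∘L L with hg
  set S : Set (E × F) := (fun p => (z, (0 : F)) + p) ⁻¹' (U ×ˢ Set.univ) with hS
  have hSo : IsOpen S := (hU.prod isOpen_univ).preimage (by fun_prop)
  have hgS : g ⁻¹' S = Set.univ := by
    ext v
    simp [hg, hS, hz]
  have h1 : (fun s => Φ (z, L s)) = (fun p => Φ ((z, (0 : F)) + p)) ∘ g := by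
    ext v
    simp [hg]
  have h2 : ContDiffOn ℝ n (fun p => Φ ((z, (0 : F)) + p)) S :=
    hΦ.comp (by fun_prop) (Set.mapsTo_preimage _ _)
  have hgs : g s ∈ S := by
    have : s ∈ g ⁻¹' S := hgS ▸ Set.mem_univ s
    exact this
  have h3 := g.iteratedFDerivWithin_comp_right h2 hSo.uniqueDiffOn
    (by rw [hgS]; exact uniqueDiffOn_univ) hgs (i := i) (by exact_mod_cast hi)
  rw [hgS, iteratedFDerivWithin_univ, ← h1, iteratedFDerivWithin_of_isOpen i hSo hgs,
    iteratedFDeriv_comp_add_left] at h3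
  have h4 : (z, (0 : F)) + g s = (z, L s) := by simp [hg]
  rw [h3, h4]
  refine (ContinuousMultilinearMap.norm_compContinuousLinearMap_le _ _).trans ?_
  rw [Finset.prod_const, Finset.card_univ, Fintype.card_fin]
  have hgL : ‖g‖ ≤ ‖L‖ := by
    refine ContinuousLinearMap.opNorm_le_bound _ (norm_nonneg _) fun v => ?_
    have : ‖g v‖ = ‖L v‖ := by simp [hg, Prod.norm_def]
    rw [this]
    exact L.le_opNorm v
  gcongr

section Local

variable {E : Type*} [NormedAddCommGroup E] [NormedSpace ℝ E] [FiniteDimensional ℝ E]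
  {M : Type*} [TopologicalSpace M] [ChartedSpace E M] [IsManifold 𝓘(ℝ, E) ∞ M]
  [RiemannianBundle (fun x : M => TangentSpace 𝓘(ℝ, E) x)]

/-- The tangent vector whose base point and components in the chart at `x` are given. -/
def ofTangentCoord (x : M) (p : E × E) : TangentBundle 𝓘(ℝ, E) M :=
  ⟨(extChartAt 𝓘(ℝ, E) x).symm p.1, ofCoord x ((extChartAt 𝓘(ℝ, E) x).symm p.1) p.2⟩

theorem contMDiffOn_ofTangentCoord (x : M) :
    ContMDiffOn 𝓘(ℝ, E × E) 𝓘(ℝ, E).tangent ∞ (ofTangentCoord (E := E) x)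
      ((extChartAt 𝓘(ℝ, E) x).target ×ˢ Set.univ) := by
  have h1 : ContMDiffOn 𝓘(ℝ, E × E) (𝓘(ℝ, E).prod 𝓘(ℝ, E)) ∞
      (fun p : E × E => ((extChartAt 𝓘(ℝ, E) x).symm p.1, p.2))
      ((extChartAt 𝓘(ℝ, E) x).target ×ˢ Set.univ) :=
    ((contMDiffOn_extChartAt_symm x).comp contDiff_fst.contMDiff.contMDiffOn
      (fun p hp => hp.1)).prodMk contDiff_snd.contMDiff.contMDiffOn
  have h2 := ((trivializationAt E (TangentSpace 𝓘(ℝ, E)) x).contMDiffOn_symm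
    (IB := 𝓘(ℝ, E)) (n := ∞)).comp h1 (fun p hp => by
      simpa [TangentBundle.trivializationAt_target] using symm_mem_source hp.1)
  refine h2.congr fun p hp => ?_
  refine Eq.trans ?_ ((trivializationAt E (TangentSpace 𝓘(ℝ, E)) x).mk_symm
    (symm_mem_source hp.1) p.2)
  exact congrArg _ ((trivializationAt E (TangentSpace 𝓘(ℝ, E)) x).symmL_apply
    (symm_mem_source hp.1) p.2)

theorem ofTangentCoord_toCoord {x y : M} (hy : y ∈ (chartAt E x).source)
    (s : TangentSpace 𝓘(ℝ, E) y) :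
    ofTangentCoord x (extChartAt 𝓘(ℝ, E) x y, toCoord x y s) = ⟨y, s⟩ := by
  simp only [ofTangentCoord]
  rw [extChartAt_symm_extChartAt hy, ofCoord_toCoord hy]

variable [IsContMDiffRiemannianBundle 𝓘(ℝ, E) ∞ E (fun x : M => TangentSpace 𝓘(ℝ, E) x)]

/-- Tangent vectors of bounded norm based near `x` have coordinates in a compact set. -/
theorem exists_isCompact_toCoord (x : M) (r : ℝ) :
    ∃ C : ℝ, ∃ B : Set (E × E), IsCompact B ∧ B ⊆ (extChartAt 𝓘(ℝ, E) x).target ×ˢ Set.univ ∧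
      ∀ᶠ y in nhds x, y ∈ (chartAt E x).source ∧ ‖toCoord (E := E) x y‖ ≤ C ∧
        ∀ s : TangentSpace 𝓘(ℝ, E) y, ‖s‖ ≤ r →
          (extChartAt 𝓘(ℝ, E) x y, toCoord x y s) ∈ B := by
  have hx := mem_chart_source E x
  have : IsContinuousRiemannianBundle E (fun x : M => TangentSpace 𝓘(ℝ, E) x) :=
    isContinuousRiemannianBundle_tangentSpace
  obtain ⟨C, -, hC⟩ := eventually_norm_trivializationAt_lt E
    (fun x : M => TangentSpace 𝓘(ℝ, E) x) x
  have hE : ProperSpace E := FiniteDimensional.proper ℝ E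
  obtain ⟨K, hK, hKt, hKc⟩ := local_compact_nhds (target_mem_nhds (extChartAt_mem_target hx))
  refine ⟨C, K ×ˢ Metric.closedBall 0 (C * r), hKc.prod (isCompact_closedBall _ _),
    Set.prod_mono hKt (Set.subset_univ _), ?_⟩
  filter_upwards [hC, (chartAt E x).open_source.mem_nhds hx,
    (continuousAt_extChartAt (I := 𝓘(ℝ, E)) x) hK] with y h1 h2 h3
  have h4 : ‖toCoord (E := E) x y‖ ≤ C := h1.le
  refine ⟨h2, h4, fun s hs => ⟨h3, ?_⟩⟩
  rw [mem_closedBall_zero_iff]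
  exact (ContinuousLinearMap.le_of_opNorm_le _ h4 s).trans
    (mul_le_mul_of_nonneg_left hs ((norm_nonneg _).trans h4))

theorem exists_isCompact_image {R : TangentBundle 𝓘(ℝ, E) M → M} (hR : IsRetraction R) {K : Set M}
    (hK : IsCompact K) (r : ℝ) : ∃ N : Set M, IsCompact N ∧
      ∀ y ∈ K, ∀ s : TangentSpace 𝓘(ℝ, E) y, ‖s‖ ≤ r → retrAt R y s ∈ N := by
  refine hK.induction_on (p := fun K => ∃ N : Set M, IsCompact N ∧
      ∀ y ∈ K, ∀ s : TangentSpace 𝓘(ℝ, E) y, ‖s‖ ≤ r → retrAt R y s ∈ N) ?_ ?_ ?_ ?_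
  · exact ⟨∅, isCompact_empty, fun y hy => hy.elim⟩
  · rintro S T hST ⟨N, hN, h⟩
    exact ⟨N, hN, fun y hy => h y (hST hy)⟩
  · rintro S T ⟨N, hN, h⟩ ⟨N', hN', h'⟩
    exact ⟨N ∪ N', hN.union hN', fun y hy s hs =>
      hy.elim (fun hy => Or.inl (h y hy s hs)) fun hy => Or.inr (h' y hy s hs)⟩
  · intro x _
    obtain ⟨C, B, hB, hBt, h⟩ := exists_isCompact_toCoord (E := E) x r
    refine ⟨_, mem_nhdsWithin_of_mem_nhds h, R '' (ofTangentCoord x '' B), ?_, ?_⟩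
    · exact (hB.image_of_continuousOn ((contMDiffOn_ofTangentCoord x).continuousOn.mono hBt)).image
        hR.smooth.continuous
    · rintro y ⟨hy, -, h1⟩ s hs
      exact ⟨_, ⟨_, h1 s hs, ofTangentCoord_toCoord hy s⟩, rfl⟩

/-- The property is local in `K`. Near each point the pullbacks are slices of one function on `E ×
E`, whose derivatives are bounded on a compact set of coordinates; the bound `C` on `toCoord`
absorbs the varying fibre norms. -/
theorem exists_norm_iteratedFDeriv_pullback_le {f : M → ℝ} {R : TangentBundle 𝓘(ℝ, E) M → M}
    {n : ℕ} (hf : ContMDiff 𝓘(ℝ, E) 𝓘(ℝ, ℝ) n f) (hR : IsRetraction R) {K : Set M}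
    (hK : IsCompact K) (r : ℝ) {i : ℕ} (hi : i ≤ n) :
    ∃ C : ℝ, ∀ y ∈ K, ∀ s : TangentSpace 𝓘(ℝ, E) y, ‖s‖ ≤ r →
      ‖iteratedFDeriv ℝ i (pullback f R y) s‖ ≤ C := by
  refine hK.induction_on (p := fun K => ∃ C : ℝ, ∀ y ∈ K, ∀ s : TangentSpace 𝓘(ℝ, E) y, ‖s‖ ≤ r →
      ‖iteratedFDeriv ℝ i (pullback f R y) s‖ ≤ C) ?_ ?_ ?_ ?_
  · exact ⟨0, fun y hy => hy.elim⟩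
  · rintro S T hST ⟨C, h⟩
    exact ⟨C, fun y hy => h y (hST hy)⟩
  · rintro S T ⟨C, h⟩ ⟨C', h'⟩
    exact ⟨max C C', fun y hy s hs => hy.elim (fun hy => (h y hy s hs).trans (le_max_left _ _))
      fun hy => (h' y hy s hs).trans (le_max_right _ _)⟩
  · intro x _
    obtain ⟨C, B, hB, hBt, h⟩ := exists_isCompact_toCoord (E := E) x r
    set Φ : E × E → ℝ := fun p => f (R (ofTangentCoord x p)) with hΦ
    have ho : IsOpen ((extChartAt 𝓘(ℝ, E) x).target) := isOpen_extChartAt_target x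
    have hΦc : ContDiffOn ℝ n Φ ((extChartAt 𝓘(ℝ, E) x).target ×ˢ Set.univ) := by
      rw [← contMDiffOn_iff_contDiffOn]
      exact (hf.comp (hR.smooth.of_le ENat.LEInfty.out)).comp_contMDiffOn
        ((contMDiffOn_ofTangentCoord x).of_le ENat.LEInfty.out)
    obtain ⟨D, hD⟩ := (hB.image_of_continuousOn ((ContinuousOn.continuousOn_iteratedFDeriv hΦc
      (ho.prod isOpen_univ) (k := i) (by exact_mod_cast hi)).mono hBt).norm).bddAbove
    refine ⟨_, mem_nhdsWithin_of_mem_nhds h, D * C ^ i, ?_⟩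
    rintro y ⟨hy, hyC, h1⟩ s hs
    have e : pullback f R y = fun s => Φ (extChartAt 𝓘(ℝ, E) x y, toCoord x y s) := by
      ext s
      rw [hΦ]
      simp only [ofTangentCoord_toCoord hy]
      rfl
    rw [e]
    have h2 : ‖iteratedFDeriv ℝ i Φ (extChartAt 𝓘(ℝ, E) x y, toCoord x y s)‖ ≤ D :=
      hD ⟨_, h1 s hs, rfl⟩
    refine (norm_iteratedFDeriv_slice_le ho hΦc (toCoord x y) (extChartAt_mem_target hy) s hi).trans
      (mul_le_mul h2 (pow_le_pow_left₀ (norm_nonneg _) hyC i) (by positivity)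
        ((norm_nonneg _).trans h2))

end Local

/-! ### Gradient and Hessian in terms of iterated derivatives. -/

section Hessian

variable {V : Type*} [NormedAddCommGroup V] [InnerProductSpace ℝ V] [CompleteSpace V]

theorem norm_gradient_eq (h : V → ℝ) (s : V) : ‖∇ h s‖ = ‖iteratedFDeriv ℝ 1 h s‖ := by
  rw [norm_iteratedFDeriv_one, gradient_eq_comp, Function.comp_apply, LinearIsometryEquiv.norm_map]

theorem fderiv_gradient_eq {h : V → ℝ} {s : V} (hh : ContDiffAt ℝ 2 h s) (u : V) :
    fderiv ℝ (∇ h) s u = (InnerProductSpace.toDual ℝ V).symm (fderiv ℝ (fderiv ℝ h) s u) := by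
  refine ext_inner_right ℝ fun v => ?_
  rw [inner_fderiv_gradient hh, InnerProductSpace.toDual_symm_apply]

theorem norm_fderiv_gradient_le {h : V → ℝ} {s : V} (hh : ContDiffAt ℝ 2 h s) :
    ‖fderiv ℝ (∇ h) s‖ ≤ ‖iteratedFDeriv ℝ 2 h s‖ := by
  rw [← norm_iteratedFDeriv_fderiv, norm_iteratedFDeriv_one]
  refine ContinuousLinearMap.opNorm_le_bound _ (norm_nonneg _) fun u => ?_
  rw [fderiv_gradient_eq hh, LinearIsometryEquiv.norm_map]
  exact ContinuousLinearMap.le_opNorm _ u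

theorem norm_fderiv_gradient_sub_le {h : V → ℝ} (hh : ContDiff ℝ 3 h) {r C : ℝ}
    (hC : ∀ s, ‖s‖ ≤ r → ‖iteratedFDeriv ℝ 3 h s‖ ≤ C) {s : V} (hs : ‖s‖ ≤ r) :
    ‖fderiv ℝ (∇ h) s - fderiv ℝ (∇ h) 0‖ ≤ C * ‖s‖ := by
  have hh2 : ContDiff ℝ 2 h := hh.of_le (by norm_num)
  have hd : Differentiable ℝ (fderiv ℝ (fderiv ℝ h)) :=
    ((hh.fderiv_right (m := 2) le_rfl).fderiv_right (m := 1) le_rfl).differentiable (by simp)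
  have hr : 0 ≤ r := (norm_nonneg s).trans hs
  have h1 : ‖fderiv ℝ (fderiv ℝ h) s - fderiv ℝ (fderiv ℝ h) 0‖ ≤ C * ‖s - 0‖ := by
    refine (convex_closedBall (0 : V) r).norm_image_sub_le_of_norm_fderiv_le
      (fun p _ => hd p) (fun p hp => ?_) (by simpa using hr) (by simpa using hs)
    rw [← norm_iteratedFDeriv_one, norm_iteratedFDeriv_fderiv, norm_iteratedFDeriv_fderiv]
    exact hC p (by simpa using hp)
  rw [sub_zero] at h1
  refine (ContinuousLinearMap.opNorm_le_bound _ (norm_nonneg _) fun u => ?_).trans h1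
  rw [sub_apply, fderiv_gradient_eq hh2.contDiffAt, fderiv_gradient_eq hh2.contDiffAt, ← map_sub,
    LinearIsometryEquiv.norm_map]
  exact ContinuousLinearMap.le_opNorm (fderiv ℝ (fderiv ℝ h) s - fderiv ℝ (fderiv ℝ h) 0) u

end Hessian

end ManifoldARC

namespace ManifoldARC

/-! ### Consequences for a run of the algorithm. -/

section Run

variable {E : Type*} [NormedAddCommGroup E] [NormedSpace ℝ E] [FiniteDimensional ℝ E]
  {M : Type*} [TopologicalSpace M] [ChartedSpace E M] [IsManifold 𝓘(ℝ, E) ∞ M]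
  [RiemannianBundle (fun x : M => TangentSpace 𝓘(ℝ, E) x)]
  {P : ARCParams} {f : M → ℝ} {R : TangentBundle 𝓘(ℝ, E) M → M}
  {x : ℕ → M} {s : ∀ k, TangentSpace 𝓘(ℝ, E) (x k)} {σ : ℕ → ℝ}

theorem Reached.of_succ {k : ℕ} (h : Reached s (k + 1)) : Reached s k :=
  fun j hj => h j (hj.trans (Nat.lt_succ_self k))

theorem IsARCRun.σmin_le (hrun : IsARCRun P f R x s σ) : ∀ k, Reached s k → P.σmin ≤ σ k := by
  intro k
  induction k with
  | zero => exact fun _ => hrun.σ_zero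
  | succ k ih =>
    intro hk
    have h0 := ih hk.of_succ
    have hpos : 0 < σ k := P.σmin_pos.trans_le h0
    rcases lt_or_ge (ratio f R (x k) (σ k) (s k)) P.η₁ with h | h
    · have h1 := (hrun.unsuccessful k hk h).1
      nlinarith [P.one_lt_γ₂]
    · rcases lt_or_ge (ratio f R (x k) (σ k) (s k)) P.η₂ with h' | h'
      · exact h0.trans (hrun.successful k hk h h').1
      · exact (le_max_left _ _).trans (hrun.very_successful k hk h').1

theorem IsARCRun.descent (hrun : IsARCRun P f R x s σ) {k : ℕ} (hk : Reached s (k + 1)) :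
    f (x (k + 1)) ≤ f (x k) := by
  rcases lt_or_ge (ratio f R (x k) (σ k) (s k)) P.η₁ with h | h
  · rw [hrun.reject k hk h]
  · rw [hrun.accept k hk h]
    by_contra! hlt
    have hσ : 0 < σ k := P.σmin_pos.trans_le (hrun.σmin_le k hk.of_succ)
    have hm := hrun.model_le k hk.of_succ
    have hden : 0 ≤ model f R (x k) (σ k) 0 - model f R (x k) (σ k) (s k) +
        σ k / 3 * ‖s k‖ ^ 3 := add_nonneg (sub_nonneg.mpr hm) (by positivity)
    -- A zero denominator is covered too: the quotient is then `0`, still below `η₁`.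
    have : ratio f R (x k) (σ k) (s k) ≤ 0 :=
      div_nonpos_of_nonpos_of_nonneg (sub_nonpos.mpr hlt.le) hden
    linarith [P.η₁_pos]

theorem IsARCRun.le_zero (hrun : IsARCRun P f R x s σ) : ∀ k, Reached s k → f (x k) ≤ f (x 0) := by
  intro k
  induction k with
  | zero => exact fun _ => le_rfl
  | succ k ih => exact fun hk => (hrun.descent hk).trans (ih hk.of_succ)

theorem model_zero (y : M) (τ : ℝ) : model f R y τ 0 = pullback f R y 0 := by
  simp [model, taylorTwo]

/-- For `‖u‖ > 1` the linear term is absorbed into the quadratic one, so the model decrease gives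
`τ₀ / 3 * ‖u‖³ ≤ (C₁ + C₂ / 2) * ‖u‖²`. -/
theorem norm_step_le {y : M} {u : TangentSpace 𝓘(ℝ, E) y} {τ τ₀ C₁ C₂ : ℝ} (hτ₀ : 0 < τ₀)
    (hτ : τ₀ ≤ τ) (h1 : ‖∇ (pullback f R y) 0‖ ≤ C₁) (h2 : ‖tangentHess (pullback f R y) 0‖ ≤ C₂)
    (hm : model f R y τ u ≤ model f R y τ 0) : ‖u‖ ≤ max 1 (3 * (C₁ + C₂ / 2) / τ₀) := by
  rcases le_or_gt ‖u‖ 1 with hu | hu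
  · exact hu.trans (le_max_left _ _)
  refine le_max_of_le_right ?_
  rw [model_zero] at hm
  simp only [model, taylorTwo] at hm
  have hC₁ : 0 ≤ C₁ := (norm_nonneg _).trans h1
  have e1 := (abs_le.mp (abs_real_inner_le_norm u (∇ (pullback f R y) 0))).1
  have e2 := (abs_le.mp (abs_real_inner_le_norm u (tangentHess (pullback f R y) 0 u))).1
  have e3 : ‖tangentHess (pullback f R y) 0 u‖ ≤ C₂ * ‖u‖ :=
    ContinuousLinearMap.le_of_opNorm_le _ h2 u
  have hu0 : 0 < ‖u‖ := zero_lt_one.trans hu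
  have e4 : ‖u‖ * ‖∇ (pullback f R y) 0‖ ≤ C₁ * ‖u‖ ^ 2 :=
    calc ‖u‖ * ‖∇ (pullback f R y) 0‖ ≤ ‖u‖ * C₁ := by gcongr
      _ = C₁ * ‖u‖ := mul_comm _ _
      _ ≤ C₁ * ‖u‖ ^ 2 := by
        gcongr
        exact le_self_pow₀ hu.le two_ne_zero
  have e5 : ‖u‖ * ‖tangentHess (pullback f R y) 0 u‖ ≤ C₂ * ‖u‖ ^ 2 :=
    calc ‖u‖ * ‖tangentHess (pullback f R y) 0 u‖ ≤ ‖u‖ * (C₂ * ‖u‖) := by gcongr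
      _ = C₂ * ‖u‖ ^ 2 := by ring
  have e6 : τ₀ / 3 * ‖u‖ ^ 3 ≤ τ / 3 * ‖u‖ ^ 3 := by gcongr
  have e7 : τ₀ / 3 * ‖u‖ ^ 3 ≤ (C₁ + C₂ / 2) * ‖u‖ ^ 2 := by linarith
  have e8 : τ₀ / 3 * ‖u‖ ≤ C₁ + C₂ / 2 := by
    refine le_of_mul_le_mul_right (a := ‖u‖ ^ 2) ?_ (by positivity)
    calc τ₀ / 3 * ‖u‖ * ‖u‖ ^ 2 = τ₀ / 3 * ‖u‖ ^ 3 := by ring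
      _ ≤ _ := e7
  rw [le_div_iff₀ hτ₀]
  linarith

theorem regularity_of_norm_tangentHess_sub_le (hf : ContMDiff 𝓘(ℝ, E) 𝓘(ℝ, ℝ) 3 f)
    (hR : IsRetraction R) {L : ℝ}
    (hL : ∀ k, Reached s k → ∀ t ∈ Set.Icc (0 : ℝ) 1,
      ‖tangentHess (pullback f R (x k)) (t • s k) - tangentHess (pullback f R (x k)) 0‖ ≤
        L * t * ‖s k‖) :
    ScalarRegularity f R s L ∧ VectorRegularity P f R s σ L 0 := by
  have hC : ∀ k, ContDiff ℝ 2 (pullback f R (x k)) := fun k =>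
    contDiff_pullback (n := 2) ENat.LEInfty.out (hf.of_le (by norm_num)) hR (x k)
  refine ⟨⟨hf.of_le (by norm_num), fun k hk => ?_⟩, continuous_const, rfl, fun k hk => ?_⟩
  · exact (le_abs_self _).trans (abs_sub_taylor_le (hC k) (hL k hk))
  · have h := norm_gradient_sub_le (hC k) (hL k hk.1.of_succ)
      (Set.right_mem_Icc.mpr (zero_le_one (α := ℝ)))
    simpa [tangentHess] using h

variable [IsContMDiffRiemannianBundle 𝓘(ℝ, E) ∞ E (fun x : M => TangentSpace 𝓘(ℝ, E) x)]

theorem IsARCRun.exists_norm_step_le (hrun : IsARCRun P f R x s σ)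
    (hf : ContMDiff 𝓘(ℝ, E) 𝓘(ℝ, ℝ) 3 f) (hR : IsRetraction R) {K : Set M} (hK : IsCompact K)
    (hxK : iterates s ⊆ K) : ∃ r : ℝ, ∀ k, Reached s k → ‖s k‖ ≤ r := by
  -- Radius `0`: the model involves derivatives of the pullback at the origin only.
  obtain ⟨C₁, h1⟩ := exists_norm_iteratedFDeriv_pullback_le (n := 3) hf hR hK 0 (i := 1)
    (by norm_num)
  obtain ⟨C₂, h2⟩ := exists_norm_iteratedFDeriv_pullback_le (n := 3) hf hR hK 0 (i := 2)
    (by norm_num)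
  refine ⟨_, fun k hk => norm_step_le P.σmin_pos (hrun.σmin_le k hk) (C₁ := C₁) (C₂ := C₂) ?_ ?_
    (hrun.model_le k hk)⟩
  · rw [norm_gradient_eq]
    exact h1 _ (hxK ⟨k, hk, rfl⟩) 0 (by simp)
  · refine (norm_fderiv_gradient_le ?_).trans (h2 _ (hxK ⟨k, hk, rfl⟩) 0 (by simp))
    exact (contDiff_pullback (n := 2) ENat.LEInfty.out (hf.of_le (by norm_num)) hR _).contDiffAt

theorem IsARCRun.exists_regularity (hrun : IsARCRun P f R x s σ)
    (hf : ContMDiff 𝓘(ℝ, E) 𝓘(ℝ, ℝ) 3 f) (hR : IsRetraction R) {K : Set M} (hK : IsCompact K)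
    (hxK : iterates s ⊆ K) :
    ∃ L : ℝ, ScalarRegularity f R s L ∧ VectorRegularity P f R s σ L 0 := by
  obtain ⟨r, hr⟩ := hrun.exists_norm_step_le hf hR hK hxK
  obtain ⟨C, hC⟩ := exists_norm_iteratedFDeriv_pullback_le (n := 3) hf hR hK r (i := 3) le_rfl
  -- `L` is a bound on the third derivatives of the pullbacks on balls of radius `r`, which contain
  -- all the partial steps.
  refine ⟨C, regularity_of_norm_tangentHess_sub_le hf hR fun k hk t ht => ?_⟩
  have hn : ‖t • s k‖ = t * ‖s k‖ := by rw [norm_smul, Real.norm_of_nonneg ht.1]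
  have h := norm_fderiv_gradient_sub_le
    (contDiff_pullback (n := 3) ENat.LEInfty.out hf hR (x k))
    (hC (x k) (hxK ⟨k, hk, rfl⟩)) (s := t • s k)
    (hn.le.trans ((mul_le_of_le_one_left (norm_nonneg _) ht.2).trans (hr k hk)))
  rw [hn, ← mul_assoc] at h
  exact h

theorem IsARCRun.exists_isCompact_retractedSteps (hrun : IsARCRun P f R x s σ)
    (hf : ContMDiff 𝓘(ℝ, E) 𝓘(ℝ, ℝ) 3 f) (hR : IsRetraction R) {K : Set M} (hK : IsCompact K)
    (hxK : iterates s ⊆ K) : ∃ N : Set M, IsCompact N ∧ retractedSteps R s ⊆ N := by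
  obtain ⟨r, hr⟩ := hrun.exists_norm_step_le hf hR hK hxK
  obtain ⟨N, hN, h⟩ := exists_isCompact_image hR hK r
  refine ⟨N, hN, ?_⟩
  rintro _ ⟨_, ⟨k, hk, t, ht, rfl⟩, rfl⟩
  refine h (x k) (hxK ⟨k, hk, rfl⟩) (t • s k) ?_
  rw [norm_smul, Real.norm_of_nonneg ht.1]
  exact (mul_le_of_le_one_left (norm_nonneg _) ht.2).trans (hr k hk)

theorem exists_isGreatest_and_regularity (hf : ContMDiff 𝓘(ℝ, E) 𝓘(ℝ, ℝ) 3 f)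
    (hR : IsRetraction R) {c₁ c₂ c₃ : ℝ}
    (hnice : SecondOrderNiceWith R (pointsAndPartialSteps s) c₁ c₂ c₃) {N : Set M}
    (hN : IsCompact N) (hsub : retractedSteps R s ⊆ N) :
    ∃ G H J : ℝ,
      IsGreatest {r : ℝ | ∃ y ∈ N, r = ‖grad (E := E) f y‖} G ∧
      IsGreatest {r : ℝ | ∃ y ∈ N, r = ‖hess (E := E) f y‖} H ∧
      IsGreatest {r : ℝ | ∃ y ∈ N, ∃ v : TangentSpace 𝓘(ℝ, E) y, ‖v‖ ≤ 1 ∧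
        r = ‖covDerivEnd (hess f) y v‖} J ∧
      ScalarRegularity f R s (c₃ * G + 2 * c₁ * c₂ * H + c₁ ^ 3 * J) ∧
      VectorRegularity P f R s σ (c₃ * G + 2 * c₁ * c₂ * H + c₁ ^ 3 * J) 0 := by
  have hmem : ∀ k, Reached s k → ∀ t ∈ Set.Icc (0 : ℝ) 1, retrAt R (x k) (t • s k) ∈ N :=
    fun k hk t ht => hsub ⟨_, ⟨k, hk, t, ht, rfl⟩, rfl⟩
  -- Iteration `0` is always reached, so `N` contains `R_{x_0}(0)`.
  have hne : N.Nonempty :=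
    ⟨_, hmem 0 (fun j hj => absurd hj (Nat.not_lt_zero j)) 0 ⟨le_rfl, zero_le_one⟩⟩
  obtain ⟨y₁, hy₁, hG⟩ := exists_forall_le_of_upperSemicontinuousAt
    (upperSemicontinuousAt_norm_grad hf) hN hne
  obtain ⟨y₂, hy₂, hH⟩ := exists_forall_le_of_upperSemicontinuousAt
    (upperSemicontinuousAt_norm_hess hf) hN hne
  obtain ⟨y₃, hy₃, hJ⟩ := exists_forall_le_of_upperSemicontinuousAt
    (upperSemicontinuousAt_norm_covDerivEndL_hess hf) hN hne
  -- The joint maximum over `y` and `v` is split: the supremum over the unit ball is the operator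
  -- norm of the bilinear map, attained by finite-dimensionality.
  obtain ⟨v, hv, hvJ⟩ := exists_norm_le_one_norm_eq (covDerivEndL (hess (E := E) f) y₃)
  have hJ' : ∀ y ∈ N, ∀ w : TangentSpace 𝓘(ℝ, E) y, ‖covDerivEnd (hess f) y w‖ ≤
      ‖covDerivEndL (hess (E := E) f) y₃‖ * ‖w‖ := fun y hy w =>
    ContinuousLinearMap.le_of_opNorm_le (covDerivEndL (hess (E := E) f) y) (hJ y hy) w
  refine ⟨_, _, _, ⟨⟨y₁, hy₁, rfl⟩, ?_⟩, ⟨⟨y₂, hy₂, rfl⟩, ?_⟩,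
    ⟨⟨y₃, hy₃, v, hv, hvJ.symm⟩, ?_⟩,
    regularity_of_norm_tangentHess_sub_le hf hR fun k hk t ht => ?_⟩
  · rintro r ⟨y, hy, rfl⟩
    exact hG y hy
  · rintro r ⟨y, hy, rfl⟩
    exact hH y hy
  · rintro r ⟨y, hy, w, hw, rfl⟩
    exact (hJ' y hy w).trans (mul_le_of_le_one_right (norm_nonneg _) hw)
  · refine norm_tangentHess_sub_le hf hR (hnice.mono ?_)
      (fun τ hτ => hG _ (hmem k hk τ hτ)) (fun τ hτ => hH _ (hmem k hk τ hτ))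
      (fun τ hτ => hJ' _ (hmem k hk τ hτ)) (norm_nonneg _) ht
    rintro _ ⟨τ, hτ, rfl⟩
    exact ⟨k, hk, τ, hτ, rfl⟩

end Run

end ManifoldARC

end

/-! ### The main theorem. -/

theorem mainTheorem5
    {E : Type*} [NormedAddCommGroup E] [NormedSpace ℝ E] [FiniteDimensional ℝ E]
    {M : Type*} [TopologicalSpace M] [T2Space M] [ChartedSpace E M] [IsManifold 𝓘(ℝ, E) ∞ M]
    [RiemannianBundle (fun x : M => TangentSpace 𝓘(ℝ, E) x)]
    [IsContMDiffRiemannianBundle 𝓘(ℝ, E) ∞ E (fun x : M => TangentSpace 𝓘(ℝ, E) x)]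
    (f : M → ℝ) (hf : ContMDiff 𝓘(ℝ, E) 𝓘(ℝ, ℝ) 3 f)
    (R : TangentBundle 𝓘(ℝ, E) M → M) (hR : ManifoldARC.IsRetraction R)
    (P : ManifoldARC.ARCParams)
    (x : ℕ → M) (s : ∀ k, TangentSpace 𝓘(ℝ, E) (x k)) (σ : ℕ → ℝ)
    (hrun : ManifoldARC.IsARCRun P f R x s σ)
    (hnice : ManifoldARC.SecondOrderNice R (ManifoldARC.pointsAndSteps s)) :
    -- main claim: the iterates remain in a compact set
    ((∃ K : Set M, IsCompact K ∧ ManifoldARC.iterates s ⊆ K) →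
      -- both regularity assumptions hold with a same `L` and `q ≡ 0`
      (∃ L : ℝ, ManifoldARC.ScalarRegularity f R s L ∧
        ManifoldARC.VectorRegularity P f R s σ L 0) ∧
      -- explicit constant, from bounds on the gradient, the Hessian and its covariant derivative on
      -- a compact set containing the retracted steps; such a set exists
      (∃ N : Set M, IsCompact N ∧ ManifoldARC.retractedSteps R s ⊆ N) ∧
      ∀ c₁ c₂ c₃ : ℝ,
        ManifoldARC.SecondOrderNiceWith R (ManifoldARC.pointsAndPartialSteps s) c₁ c₂ c₃ →
        ∀ N : Set M, IsCompact N → ManifoldARC.retractedSteps R s ⊆ N →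
          ∃ G H J : ℝ,
            IsGreatest {r : ℝ | ∃ y ∈ N, r = ‖ManifoldARC.grad (E := E) f y‖} G ∧
            IsGreatest {r : ℝ | ∃ y ∈ N, r = ‖ManifoldARC.hess (E := E) f y‖} H ∧
            IsGreatest {r : ℝ | ∃ y ∈ N, ∃ v : TangentSpace 𝓘(ℝ, E) y, ‖v‖ ≤ 1 ∧
              r = ‖ManifoldARC.covDerivEnd (ManifoldARC.hess f) y v‖} J ∧
            ManifoldARC.ScalarRegularity f R s (c₃ * G + 2 * c₁ * c₂ * H + c₁ ^ 3 * J) ∧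
            ManifoldARC.VectorRegularity P f R s σ (c₃ * G + 2 * c₁ * c₂ * H + c₁ ^ 3 * J) 0) ∧
    -- descent method, so compactness of the sublevel set is enough, a fortiori that of `M`
    (∀ k, ManifoldARC.Reached s (k + 1) → f (x (k + 1)) ≤ f (x k)) ∧
    (IsCompact {y : M | f y ≤ f (x 0)} →
      ∃ K : Set M, IsCompact K ∧ ManifoldARC.iterates s ⊆ K) ∧
    (CompactSpace M → IsCompact {y : M | f y ≤ f (x 0)}) := by
  refine ⟨?_, fun k hk => hrun.descent hk, fun hc => ⟨_, hc, ?_⟩, fun hM => ?_⟩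
  · rintro ⟨K, hK, hxK⟩
    exact ⟨hrun.exists_regularity hf hR hK hxK, hrun.exists_isCompact_retractedSteps hf hR hK hxK,
      fun c₁ c₂ c₃ hc N hN hsub =>
        ManifoldARC.exists_isGreatest_and_regularity hf hR hc hN hsub⟩
  · rintro _ ⟨k, hk, rfl⟩
    exact hrun.le_zero k hk
  · exact (isClosed_le hf.continuous continuous_const).isCompact
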